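/- Let $K$ be a field and let $E$ be a finite directed graph (finitely many vertices $E^0$ and edges $E^1$, loops and multiple edges allowed, source and range maps $s,r:E^1\to E^0$) with no sinks, i.e. every vertex is the source of at least one edge. Let $A$ be its adjacency matrix, $A_{uv}$ being the number of edges from $u$ to $v$, and let $A^t$ be its transpose. Let $\mathcal L(E)$ be the Leavitt path algebra of $E$ over $K$, generated by the vertices $v$, the edges $\alpha$ and the ghost edges $\alpha^*$ subject to $vw=\delta_{vw}v$; $s(\alpha)\alpha=\alpha r(\alpha)=\alpha$; $r(\alpha)\alpha^*=\alpha^*s(\alpha)=\alpha^*$; $\alpha^*\beta=\delta_{\alpha\beta}r(\alpha)$; and $\sum_{s(\alpha)=v}\alpha\alpha^*=v$ for every vertex $v$ that emits an edge. Its identity is the sum of the vertices. Grade it by $\mathbb Z$ with $\deg v=0$, $\deg\alpha=1$, $\deg\alpha^*=-1$. Let $K_0^{\mathrm{gr}}(\mathcal L(E))$ be the group completion of the monoid $\mathcal V^{\mathrm{gr}}$ of graded isomorphism classes of graded finitely generated projective right $\mathcal L(E)$-modules under direct sum, let $K_0^{\mathrm{gr}}(\mathcal L(E))^+$ be the image of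 $\mathcal V^{\mathrm{gr}}$ in it, and let $\mathbb Z[x,x^{-1}]$ act by $x^{n}[P]=[P(n)]$, where $P(n)_i=P_{n+i}$. Let $\Delta_{A^t}$ be the direct limit of the system $\mathbb Z^{E^0}\xrightarrow{A^t}\mathbb Z^{E^0}\xrightarrow{A^t}\mathbb Z^{E^0}\xrightarrow{A^t}\cdots$, where $A^t$ acts on column vectors from the left; write $[a,k]$ for the class of $a$ in the $k$-th copy. Let $\Delta_{A^t}^+=\{[a,k] : a\in\mathbb Z_{\ge 0}^{E^0},\ k\ge 0\}$, and let $\delta_{A^t}$ be the automorphism $[a,k]\mapsto[A^ta,k]$ of $\Delta_{A^t}$. Then there is an isomorphism of abelian groups $$\phi: K_0^{\mathrm{gr}}(\mathcal L(E))\longrightarrow \Delta_{A^t}$$ such that $\phi(x\alpha)=\delta_{A^t}(\phi(\alpha))$ for all $\alpha\in K_0^{\mathrm{gr}}(\mathcal L(E))$, and $\phi\big(K_0^{\mathrm{gr}}(\mathcal L(E))^+\big)=\Delta_{A^t}^+$. -/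

import Mathlib

open scoped DirectSum LaurentPolynomial

universe u v w

/-! ### Directed graphs and their adjacency matrices -/

/-- A directed graph with vertex set `V` and edge set `W`, given by source and range maps
(loops and multiple edges are allowed). -/
structure DirectedGraph (V : Type v) (W : Type w) where
  /-- source of an edge -/
  s : W → V
  /-- range of an edge -/
  r : W → V

namespace DirectedGraph

variable {V : Type v} {W : Type w}

/-- Every vertex emits at least one edge. -/
def NoSinks (E : DirectedGraph V W) : Prop := ∀ x : V, ∃ e : W, E.s e = x

/-- The entry at `(x, y)` is the number of edges from `x` to `y`. -/
noncomputable def adjMatrix (E : DirectedGraph V W) : Matrix V V ℤ :=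
  Matrix.of fun x y => (Nat.card {e : W // E.s e = x ∧ E.r e = y} : ℤ)

end DirectedGraph

/-! ### Leavitt path algebras of finite graphs -/

/-- The generators of a Leavitt path algebra: vertices, edges and ghost edges. -/
inductive LeavittGen (V : Type v) (W : Type w) : Type (max v w)
  | vertex (x : V)
  | edge (e : W)
  | ghost (e : W)

namespace LeavittGen

variable {V : Type v} {W : Type w}

/-- The standard degrees: vertices `0`, edges `1`, ghost edges `-1`. -/
def deg : LeavittGen V W → ℤ
  | vertex _ => 0
  | edge _ => 1
  | ghost _ => -1

end LeavittGen

section Leavitt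

variable (K : Type u) [Field K] {V : Type v} {W : Type w} [Fintype V] [Fintype W]

open LeavittGen in
open Classical in
/-- The defining relations of the Leavitt path algebra of a finite graph. The algebra of a finite
graph has an identity, namely the sum of the vertices; as `FreeAlgebra` is the free *unital*
algebra, this is the relation `one`. -/
inductive LeavittRel (E : DirectedGraph V W) :
    FreeAlgebra K (LeavittGen V W) → FreeAlgebra K (LeavittGen V W) → Prop
  | one : LeavittRel E (∑ x : V, FreeAlgebra.ι K (vertex x)) 1
  | vertex_mul_vertex (x y : V) :
      LeavittRel E (FreeAlgebra.ι K (vertex x) * FreeAlgebra.ι K (vertex y))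
        (if x = y then FreeAlgebra.ι K (vertex x) else 0)
  | source_mul_edge (e : W) :
      LeavittRel E (FreeAlgebra.ι K (vertex (E.s e)) * FreeAlgebra.ι K (edge e))
        (FreeAlgebra.ι K (edge e))
  | edge_mul_range (e : W) :
      LeavittRel E (FreeAlgebra.ι K (edge e) * FreeAlgebra.ι K (vertex (E.r e)))
        (FreeAlgebra.ι K (edge e))
  | range_mul_ghost (e : W) :
      LeavittRel E (FreeAlgebra.ι K (vertex (E.r e)) * FreeAlgebra.ι K (ghost e))
        (FreeAlgebra.ι K (ghost e))
  | ghost_mul_source (e : W) :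
      LeavittRel E (FreeAlgebra.ι K (ghost e) * FreeAlgebra.ι K (vertex (E.s e)))
        (FreeAlgebra.ι K (ghost e))
  | ghost_mul_edge (e f : W) :
      LeavittRel E (FreeAlgebra.ι K (ghost e) * FreeAlgebra.ι K (edge f))
        (if e = f then FreeAlgebra.ι K (vertex (E.r e)) else 0)
  | sum_edge_mul_ghost (x : V) (hx : ∃ e : W, E.s e = x) :
      LeavittRel E
        (∑ e : W with E.s e = x, FreeAlgebra.ι K (edge e) * FreeAlgebra.ι K (ghost e))
        (FreeAlgebra.ι K (vertex x))

/-- The Leavitt path algebra of a finite graph `E` with coefficients in the field `K`. -/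
def LeavittPathAlgebra (E : DirectedGraph V W) : Type (max u v w) :=
  RingQuot (LeavittRel K E)

noncomputable instance (E : DirectedGraph V W) : Ring (LeavittPathAlgebra K E) :=
  inferInstanceAs (Ring (RingQuot (LeavittRel K E)))

noncomputable instance (E : DirectedGraph V W) : Algebra K (LeavittPathAlgebra K E) :=
  inferInstanceAs (Algebra K (RingQuot (LeavittRel K E)))

namespace LeavittPathAlgebra

/-- The quotient map from the free algebra. -/
noncomputable def mk (E : DirectedGraph V W) :
    FreeAlgebra K (LeavittGen V W) →ₐ[K] LeavittPathAlgebra K E :=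
  RingQuot.mkAlgHom K (LeavittRel K E)

/-- A generator as an element of the Leavitt path algebra. -/
noncomputable def gen (E : DirectedGraph V W) (g : LeavittGen V W) : LeavittPathAlgebra K E :=
  mk K E (FreeAlgebra.ι K g)

/-- The standard `ℤ`-grading: the component of degree `k` is spanned by the words in the generators
of total degree `k`. (The empty word is the identity, the sum of the vertices.) -/
noncomputable def grading (E : DirectedGraph V W) (k : ℤ) :
    Submodule K (LeavittPathAlgebra K E) :=
  Submodule.span K {a | ∃ l : List (LeavittGen V W),
    (l.map LeavittGen.deg).sum = k ∧ a = (l.map (gen K E)).prod}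

lemma gen_mem (E : DirectedGraph V W) (g : LeavittGen V W) : gen K E g ∈ grading K E g.deg :=
  Submodule.subset_span ⟨[g], by simp, by simp⟩

instance (E : DirectedGraph V W) : SetLike.GradedMonoid (grading K E) where
  one_mem := Submodule.subset_span ⟨[], by simp, by simp⟩
  mul_mem := by
    intro i j a b ha hb
    have h := Submodule.mul_mem_mul ha hb
    rw [grading, grading, Submodule.span_mul_span] at h
    refine Submodule.span_mono ?_ h
    rintro _ ⟨_, ⟨l, hl, rfl⟩, _, ⟨m, hm, rfl⟩, rfl⟩
    exact ⟨l ++ m, by simp [hl, hm], by simp⟩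

lemma of_mul_of_eq (E : DirectedGraph V W) {i j k : ℤ} (h : i + j = k)
    {a b c : LeavittPathAlgebra K E} (ha : a ∈ grading K E i) (hb : b ∈ grading K E j)
    (hc : c ∈ grading K E k) (habc : a * b = c) :
    (DirectSum.of (fun i => grading K E i) i ⟨a, ha⟩ : ⨁ i, grading K E i) *
      DirectSum.of (fun i => grading K E i) j ⟨b, hb⟩ =
      DirectSum.of (fun i => grading K E i) k ⟨c, hc⟩ := by
  subst h
  subst habc
  rw [DirectSum.of_mul_of]
  rfl

/-- The homogeneous version of a generator. -/
noncomputable def homGen (E : DirectedGraph V W) (g : LeavittGen V W) : ⨁ i, grading K E i :=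
  DirectSum.of (fun i => grading K E i) g.deg ⟨gen K E g, gen_mem K E g⟩

lemma sum_of_eq (E : DirectedGraph V W) {ι : Type*} (t : Finset ι) {k : ℤ}
    (a : ι → LeavittPathAlgebra K E) (ha : ∀ x, a x ∈ grading K E k) {c : LeavittPathAlgebra K E}
    (hc : c ∈ grading K E k) (h : ∑ x ∈ t, a x = c) :
    ∑ x ∈ t, (DirectSum.of (fun i => grading K E i) k ⟨a x, ha x⟩ : ⨁ i, grading K E i) =
      DirectSum.of (fun i => grading K E i) k ⟨c, hc⟩ := by
  rw [← map_sum]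
  congr 1
  apply Subtype.ext
  simpa using h

lemma mk_eq (E : DirectedGraph V W) {a b : FreeAlgebra K (LeavittGen V W)}
    (h : LeavittRel K E a b) : mk K E a = mk K E b :=
  RingQuot.mkAlgHom_rel K h

open LeavittGen in
lemma homGen_rel (E : DirectedGraph V W) ⦃a b : FreeAlgebra K (LeavittGen V W)⦄
    (h : LeavittRel K E a b) :
    FreeAlgebra.lift K (homGen K E) a = FreeAlgebra.lift K (homGen K E) b := by
  classical
  have key := mk_eq K E h
  cases h with
  | one =>
    simp only [map_sum, map_one, FreeAlgebra.lift_ι_apply] at key ⊢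
    exact sum_of_eq K E _ (fun x => gen K E (vertex x)) (fun x => gen_mem K E (vertex x)) _ key
  | vertex_mul_vertex x y =>
    simp only [map_mul, FreeAlgebra.lift_ι_apply] at key ⊢
    split_ifs at key ⊢ with hxy
    · rw [FreeAlgebra.lift_ι_apply]
      exact of_mul_of_eq K E rfl _ _ _ key
    · rw [map_zero] at key ⊢
      refine (of_mul_of_eq K E (k := 0) rfl _ _ (Submodule.zero_mem _) key).trans ?_
      exact map_zero _
  | source_mul_edge e =>
    simp only [map_mul, FreeAlgebra.lift_ι_apply] at key ⊢
    exact of_mul_of_eq K E rfl _ _ _ key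
  | edge_mul_range e =>
    simp only [map_mul, FreeAlgebra.lift_ι_apply] at key ⊢
    exact of_mul_of_eq K E rfl _ _ _ key
  | range_mul_ghost e =>
    simp only [map_mul, FreeAlgebra.lift_ι_apply] at key ⊢
    exact of_mul_of_eq K E rfl _ _ _ key
  | ghost_mul_source e =>
    simp only [map_mul, FreeAlgebra.lift_ι_apply] at key ⊢
    exact of_mul_of_eq K E rfl _ _ _ key
  | ghost_mul_edge e f =>
    simp only [map_mul, FreeAlgebra.lift_ι_apply] at key ⊢
    split_ifs at key ⊢ with hxy
    · rw [FreeAlgebra.lift_ι_apply]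
      exact of_mul_of_eq K E rfl _ _ _ key
    · rw [map_zero] at key ⊢
      refine (of_mul_of_eq K E (k := 0) rfl _ _ (Submodule.zero_mem _) key).trans ?_
      exact map_zero _
  | sum_edge_mul_ghost x hx =>
    have hmem : ∀ e : W, gen K E (edge e) * gen K E (ghost e) ∈ grading K E 0 := fun e =>
      Submodule.subset_span ⟨[edge e, ghost e], by simp [LeavittGen.deg], by simp⟩
    simp only [map_sum, map_mul, FreeAlgebra.lift_ι_apply] at key ⊢
    have : ∀ e : W, homGen K E (edge e) * homGen K E (ghost e) =
        DirectSum.of (fun i => grading K E i) 0 ⟨_, hmem e⟩ := fun e =>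
      of_mul_of_eq K E (i := 1) (j := -1) (k := 0) (by norm_num) (gen_mem K E (edge e))
        (gen_mem K E (ghost e)) (hmem e) rfl
    simp only [this]
    exact sum_of_eq K E _ (fun e => gen K E (edge e) * gen K E (ghost e)) hmem
      (gen_mem K E (vertex x)) key

/-- The decomposition into homogeneous components, as an algebra homomorphism. -/
noncomputable def decomposeHom (E : DirectedGraph V W) :
    LeavittPathAlgebra K E →ₐ[K] ⨁ i, grading K E i :=
  RingQuot.liftAlgHom K ⟨FreeAlgebra.lift K (homGen K E), homGen_rel K E⟩

lemma decomposeHom_mk (E : DirectedGraph V W) (a : FreeAlgebra K (LeavittGen V W)) :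
    decomposeHom K E (mk K E a) = FreeAlgebra.lift K (homGen K E) a :=
  RingQuot.liftAlgHom_mkAlgHom_apply K _ _ _

lemma decomposeHom_word (E : DirectedGraph V W) (l : List (LeavittGen V W)) (k : ℤ)
    (hl : (l.map LeavittGen.deg).sum = k) (h : (l.map (gen K E)).prod ∈ grading K E k) :
    decomposeHom K E (l.map (gen K E)).prod =
      DirectSum.of (fun i => grading K E i) k ⟨_, h⟩ := by
  induction l generalizing k with
  | nil => subst hl; simp only [List.map_nil, List.prod_nil, map_one]; rfl
  | cons g l ih =>
    subst hl
    have h' : (l.map (gen K E)).prod ∈ grading K E (l.map LeavittGen.deg).sum :=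
      Submodule.subset_span ⟨l, rfl, rfl⟩
    simp only [List.map_cons, List.prod_cons, map_mul]
    rw [ih _ rfl h', show decomposeHom K E (gen K E g) = homGen K E g from
      (decomposeHom_mk K E _).trans (FreeAlgebra.lift_ι_apply _ _)]
    exact of_mul_of_eq K E (by simp) _ _ _ rfl

noncomputable instance (E : DirectedGraph V W) : GradedAlgebra (grading K E) :=
  GradedAlgebra.ofAlgHom (grading K E) (decomposeHom K E)
    (by
      have : ((DirectSum.coeAlgHom (grading K E)).comp (decomposeHom K E)).comp (mk K E) =
          (AlgHom.id K _).comp (mk K E) := by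
        apply FreeAlgebra.hom_ext
        funext g
        simp only [Function.comp_apply, AlgHom.comp_apply, decomposeHom_mk,
          FreeAlgebra.lift_ι_apply, homGen, DirectSum.coeAlgHom_of, AlgHom.id_apply]
        rfl
      ext a
      obtain ⟨b, rfl⟩ := RingQuot.mkAlgHom_surjective K (LeavittRel K E) a
      exact DFunLike.congr_fun this b)
    (by
      rintro i ⟨x, hx⟩
      induction hx using Submodule.span_induction with
      | mem x hx' =>
        obtain ⟨l, hl, rfl⟩ := hx'
        exact decomposeHom_word K E l i hl _
      | zero => rw [map_zero]; exact (map_zero _).symm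
      | add x y hx hy ihx ihy =>
        simp only [map_add] at ihx ihy ⊢
        rw [ihx, ihy, ← map_add]
        rfl
      | smul c x hx ih =>
        simp only [map_smul] at ih ⊢
        rw [ih]
        exact (DirectSum.lof_eq_of K _ (fun i => grading K E i) i ⟨x, hx⟩ ▸
          (map_smul (DirectSum.lof K _ (fun i => grading K E i) i) c ⟨x, hx⟩).symm))

end LeavittPathAlgebra

end Leavitt

/-! ### The graded Grothendieck group -/

section Graded

variable {K : Type v} {A : Type u} [CommRing K] [Ring A] [Algebra K A]

/-- A graded finitely generated projective right module over a `ℤ`-graded algebra `A`; right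
`A`-modules are modules over the opposite ring. The carriers lie in the universe of `A`, where every
finitely generated module has an isomorphic copy. For graded modules, being projective as a module and
being projective in the category of graded modules are the same. -/
structure GrProjModule (𝒜 : ℤ → Submodule K A) [GradedAlgebra 𝒜] : Type (u + 1) where
  carrier : Type u
  [addCommGroup : AddCommGroup carrier]
  [module : Module Aᵐᵒᵖ carrier]
  /-- the homogeneous components -/
  deg : ℤ → AddSubgroup carrier
  isInternal : DirectSum.IsInternal deg
  smul_mem : ∀ ⦃i j : ℤ⦄ ⦃m : carrier⦄ ⦃a : A⦄, m ∈ deg i → a ∈ 𝒜 j →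
    MulOpposite.op a • m ∈ deg (i + j)
  finite : Module.Finite Aᵐᵒᵖ carrier
  projective : Module.Projective Aᵐᵒᵖ carrier

attribute [instance] GrProjModule.addCommGroup GrProjModule.module

namespace GrProjModule

variable {𝒜 : ℤ → Submodule K A} [GradedAlgebra 𝒜]

/-- Graded isomorphism: an `A`-linear isomorphism matching the homogeneous components. -/
def GrIso (P Q : GrProjModule 𝒜) : Prop :=
  ∃ e : P.carrier ≃ₗ[Aᵐᵒᵖ] Q.carrier, ∀ (i : ℤ) (m : P.carrier), e m ∈ Q.deg i ↔ m ∈ P.deg i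

lemma GrIso.refl (P : GrProjModule 𝒜) : GrIso P P := ⟨LinearEquiv.refl _ _, fun _ _ => Iff.rfl⟩

lemma GrIso.symm {P Q : GrProjModule 𝒜} : GrIso P Q → GrIso Q P := by
  rintro ⟨e, he⟩
  exact ⟨e.symm, fun i m => by rw [← he, e.apply_symm_apply]⟩

lemma GrIso.trans {P Q R : GrProjModule 𝒜} : GrIso P Q → GrIso Q R → GrIso P R := by
  rintro ⟨e, he⟩ ⟨f, hf⟩
  exact ⟨e.trans f, fun i m => by rw [LinearEquiv.trans_apply, hf, he]⟩

instance setoid (𝒜 : ℤ → Submodule K A) [GradedAlgebra 𝒜] : Setoid (GrProjModule 𝒜) where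
  r := GrIso
  iseqv := ⟨GrIso.refl, GrIso.symm, GrIso.trans⟩

lemma isInternal_prod {M N : Type*} [AddCommGroup M] [AddCommGroup N] {p : ℤ → AddSubgroup M}
    {q : ℤ → AddSubgroup N} (hp : DirectSum.IsInternal p) (hq : DirectSum.IsInternal q) :
    DirectSum.IsInternal fun i => (p i).prod (q i) := by
  classical
  let l : (⨁ i, p i) →+ ⨁ i, (p i).prod (q i) := DirectSum.map fun i =>
    AddMonoidHom.mk' (fun x : p i => (⟨(x.1, 0), x.2, zero_mem _⟩ : (p i).prod (q i)))
      (fun _ _ => by ext <;> simp)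
  let r : (⨁ i, q i) →+ ⨁ i, (p i).prod (q i) := DirectSum.map fun i =>
    AddMonoidHom.mk' (fun x : q i => (⟨(0, x.1), zero_mem _, x.2⟩ : (p i).prod (q i)))
      (fun _ _ => by ext <;> simp)
  let ep := AddEquiv.ofBijective _ hp
  let eq := AddEquiv.ofBijective _ hq
  have hep : ∀ i (x : p i), ep.symm x = DirectSum.of (fun i => p i) i x := fun i x => by
    rw [AddEquiv.symm_apply_eq]; exact (DirectSum.coeAddMonoidHom_of p i x).symm
  have heq : ∀ i (x : q i), eq.symm x = DirectSum.of (fun i => q i) i x := fun i x => by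
    rw [AddEquiv.symm_apply_eq]; exact (DirectSum.coeAddMonoidHom_of q i x).symm
  let inv : M × N →+ ⨁ i, (p i).prod (q i) :=
    (l.comp ep.symm.toAddMonoidHom).coprod (r.comp eq.symm.toAddMonoidHom)
  let c := DirectSum.coeAddMonoidHom fun i => (p i).prod (q i)
  have h1 : inv.comp c = AddMonoidHom.id _ := by
    apply DirectSum.addHom_ext
    rintro i ⟨⟨x, y⟩, hx, hy⟩
    have hx' := hep i ⟨x, hx⟩
    have hy' := heq i ⟨y, hy⟩
    simp only at hx' hy'
    simp only [inv, c, l, r, AddMonoidHom.comp_apply, DirectSum.coeAddMonoidHom_of,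
      AddMonoidHom.coprod_apply, AddEquiv.coe_toAddMonoidHom, hx', hy', DirectSum.map_of,
      AddMonoidHom.id_apply]
    rw [← map_add]
    congr 1
    ext <;> simp
  have h2l : (c.comp l) = (AddMonoidHom.inl M N).comp (DirectSum.coeAddMonoidHom p) := by
    apply DirectSum.addHom_ext
    intro i x
    simp [c, l, DirectSum.map_of]
  have h2r : (c.comp r) = (AddMonoidHom.inr M N).comp (DirectSum.coeAddMonoidHom q) := by
    apply DirectSum.addHom_ext
    intro i x
    simp [c, r, DirectSum.map_of]
  refine Function.bijective_iff_has_inverse.2 ⟨inv, DFunLike.congr_fun h1, ?_⟩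
  rintro ⟨x, y⟩
  have e1 := DFunLike.congr_fun h2l (ep.symm x)
  have e2 := DFunLike.congr_fun h2r (eq.symm y)
  have e3 : DirectSum.coeAddMonoidHom p (ep.symm x) = x := ep.apply_symm_apply x
  have e4 : DirectSum.coeAddMonoidHom q (eq.symm y) = y := eq.apply_symm_apply y
  simp only [AddMonoidHom.comp_apply, e3, e4] at e1 e2
  change c (l (ep.symm x) + r (eq.symm y)) = _
  rw [map_add, e1, e2]
  simp

/-- The direct sum of graded modules, `(P ⊕ Q)ᵢ = Pᵢ ⊕ Qᵢ`. -/
def directSum (P Q : GrProjModule 𝒜) : GrProjModule 𝒜 where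
  carrier := P.carrier × Q.carrier
  deg i := (P.deg i).prod (Q.deg i)
  isInternal := isInternal_prod P.isInternal Q.isInternal
  smul_mem _ _ _ _ hm ha := ⟨P.smul_mem hm.1 ha, Q.smul_mem hm.2 ha⟩
  finite := by have := P.finite; have := Q.finite; infer_instance
  projective := by have := P.projective; have := Q.projective; infer_instance

/-- The zero module. -/
def trivial (𝒜 : ℤ → Submodule K A) [GradedAlgebra 𝒜] : GrProjModule 𝒜 where
  carrier := PUnit
  deg _ := ⊤
  isInternal := by
    refine ⟨fun x y _ => ?_, fun x =>
      ⟨DirectSum.of (fun _ : ℤ => (⊤ : AddSubgroup PUnit)) 0 0, Subsingleton.elim _ _⟩⟩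
    apply DFinsupp.ext
    intro i
    exact Subsingleton.elim (α := (⊤ : AddSubgroup PUnit)) _ _
  smul_mem _ _ _ _ _ _ := AddSubgroup.mem_top _
  finite := inferInstance
  projective := inferInstance

/-- The shift `P(γ)`, with components `P(γ)ᵢ = P_{γ + i}`. -/
def shift (γ : ℤ) (P : GrProjModule 𝒜) : GrProjModule 𝒜 where
  carrier := P.carrier
  deg i := P.deg (γ + i)
  isInternal := by
    let h : ℤ ≃ ℤ := (Equiv.addLeft γ).symm
    let e : (⨁ i, P.deg i) ≃+ ⨁ i, P.deg (γ + i) :=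
      DirectSum.equivCongrLeft (β := fun i => P.deg i) h
    have he : ∀ (k : ℤ) (x : P.deg (γ + k)), e.symm (DirectSum.of (fun i => P.deg (γ + i)) k x) =
        DirectSum.of (fun i => P.deg i) (γ + k) x := by
      intro k x
      rw [AddEquiv.symm_apply_eq]
      apply DFinsupp.ext
      intro k'
      refine Eq.trans ?_ (DirectSum.equivCongrLeft_apply (β := fun i => P.deg i) h _ k').symm
      rcases eq_or_ne k k' with rfl | hk
      · exact (DirectSum.of_eq_same (β := fun i => P.deg (γ + i)) k x).trans
          (DirectSum.of_eq_same (β := fun i => P.deg i) (γ + k) x).symm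
      · exact (DirectSum.of_eq_of_ne (β := fun i => P.deg (γ + i)) k k' x hk.symm).trans
          (DirectSum.of_eq_of_ne (β := fun i => P.deg i) (γ + k) (γ + k') x fun hh => hk (add_left_cancel hh).symm).symm
    have hc : (DirectSum.coeAddMonoidHom fun i => P.deg (γ + i)) =
        (DirectSum.coeAddMonoidHom P.deg).comp e.symm.toAddMonoidHom := by
      apply DirectSum.addHom_ext
      intro k x
      rw [DirectSum.coeAddMonoidHom_of, AddMonoidHom.comp_apply]
      exact (congrArg _ (he k x)).trans (DirectSum.coeAddMonoidHom_of P.deg (γ + k) x) |>.symm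
    unfold DirectSum.IsInternal
    rw [hc]
    exact P.isInternal.comp e.symm.bijective
  smul_mem i j m a hm ha := by rw [← add_assoc]; exact P.smul_mem hm ha
  finite := P.finite
  projective := P.projective

end GrProjModule

open GrProjModule

/-- The monoid `𝒱ᵍʳ` of graded isomorphism classes of graded finitely generated projective right
modules. -/
def GrV (𝒜 : ℤ → Submodule K A) [GradedAlgebra 𝒜] : Type (u + 1) :=
  Quotient (GrProjModule.setoid 𝒜)

namespace GrV

variable (𝒜 : ℤ → Submodule K A) [GradedAlgebra 𝒜]

instance : Zero (GrV 𝒜) := ⟨Quotient.mk _ (GrProjModule.trivial 𝒜)⟩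

/-- `[P] + [Q] = [P ⊕ Q]` -/
instance : Add (GrV 𝒜) where
  add := Quotient.map₂ directSum <| by
    rintro P P' ⟨e, he⟩ Q Q' ⟨f, hf⟩
    exact ⟨e.prodCongr f, fun i m => and_congr (he i m.1) (hf i m.2)⟩

instance : AddCommMonoid (GrV 𝒜) where
  add_assoc := by
    rintro ⟨P⟩ ⟨Q⟩ ⟨R⟩
    exact Quotient.sound ⟨LinearEquiv.prodAssoc _ _ _ _, fun i m => and_assoc.symm⟩
  add_comm := by
    rintro ⟨P⟩ ⟨Q⟩
    exact Quotient.sound ⟨LinearEquiv.prodComm _ _ _, fun i m => and_comm⟩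
  zero_add := by
    rintro ⟨P⟩
    exact Quotient.sound ⟨(LinearEquiv.uniqueProd :
      (PUnit.{u + 1} × P.carrier) ≃ₗ[Aᵐᵒᵖ] P.carrier),
      fun i m => (and_iff_right (AddSubgroup.mem_top m.1)).symm⟩
  add_zero := by
    rintro ⟨P⟩
    exact Quotient.sound ⟨(LinearEquiv.prodUnique :
      (P.carrier × PUnit.{u + 1}) ≃ₗ[Aᵐᵒᵖ] P.carrier),
      fun i m => (and_iff_left (AddSubgroup.mem_top m.2)).symm⟩
  nsmul := nsmulRec

/-- The action of `γ ∈ ℤ` on `𝒱ᵍʳ`: `γ • [P] = [P(γ)]`. -/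
def shift (γ : ℤ) : GrV 𝒜 →+ GrV 𝒜 where
  toFun := Quotient.map (GrProjModule.shift γ) <| by
    rintro P P' ⟨e, he⟩
    exact ⟨e, fun i m => he (γ + i) m⟩
  map_zero' := rfl
  map_add' := by rintro ⟨P⟩ ⟨Q⟩; rfl

lemma shift_zero : shift 𝒜 0 = AddMonoidHom.id _ := by
  ext ⟨P⟩
  refine Quotient.sound ⟨LinearEquiv.refl _ _, fun i m => ?_⟩
  change m ∈ P.deg i ↔ m ∈ P.deg (0 + i)
  rw [zero_add]

lemma shift_add (γ δ : ℤ) : shift 𝒜 (γ + δ) = (shift 𝒜 γ).comp (shift 𝒜 δ) := by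
  ext ⟨P⟩
  refine Quotient.sound ⟨LinearEquiv.refl _ _, fun i m => ?_⟩
  change m ∈ P.deg (δ + (γ + i)) ↔ m ∈ P.deg (γ + δ + i)
  rw [show δ + (γ + i) = γ + δ + i by ring]

end GrV

/-- The graded Grothendieck group: the group completion of `𝒱ᵍʳ`. -/
def GrK0 (𝒜 : ℤ → Submodule K A) [GradedAlgebra 𝒜] : Type (u + 1) :=
  Algebra.GrothendieckAddGroup (GrV 𝒜)

namespace GrK0

variable (𝒜 : ℤ → Submodule K A) [GradedAlgebra 𝒜]

noncomputable instance : AddCommGroup (GrK0 𝒜) :=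
  inferInstanceAs (AddCommGroup (Algebra.GrothendieckAddGroup (GrV 𝒜)))

/-- The canonical homomorphism `𝒱ᵍʳ → K₀ᵍʳ`. -/
noncomputable def of : GrV 𝒜 →+ GrK0 𝒜 := Algebra.GrothendieckAddGroup.of

/-- The positive cone: the set of classes of graded finitely generated projective modules. -/
def cone : Set (GrK0 𝒜) := Set.range (of 𝒜)

/-- The endomorphism of `K₀ᵍʳ` induced by a shift. -/
noncomputable def shift (γ : ℤ) : GrK0 𝒜 →+ GrK0 𝒜 :=
  Algebra.GrothendieckAddGroup.lift ((of 𝒜).comp (GrV.shift 𝒜 γ))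

lemma shift_of (γ : ℤ) (p : GrV 𝒜) : shift 𝒜 γ (of 𝒜 p) = of 𝒜 (GrV.shift 𝒜 γ p) :=
  DFunLike.congr_fun
    (Algebra.GrothendieckAddGroup.lift.symm_apply_apply ((of 𝒜).comp (GrV.shift 𝒜 γ))) p

lemma hom_ext {f g : GrK0 𝒜 →+ GrK0 𝒜} (h : ∀ p, f (of 𝒜 p) = g (of 𝒜 p)) : f = g :=
  Algebra.GrothendieckAddGroup.lift.symm.injective (AddMonoidHom.ext h)

/-- The action of `ℤ` on `K₀ᵍʳ` by shifts. -/
noncomputable def shiftHom : Multiplicative ℤ →* Module.End ℤ (GrK0 𝒜) where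
  toFun γ := (shift 𝒜 γ.toAdd).toIntLinearMap
  map_one' := by
    have : shift 𝒜 0 = AddMonoidHom.id _ := hom_ext 𝒜 fun p => by
      rw [shift_of, GrV.shift_zero]; rfl
    ext a
    exact DFunLike.congr_fun this a
  map_mul' γ δ := by
    have : shift 𝒜 (γ.toAdd + δ.toAdd) = (shift 𝒜 γ.toAdd).comp (shift 𝒜 δ.toAdd) :=
      hom_ext 𝒜 fun p => by
        rw [AddMonoidHom.comp_apply, shift_of, shift_of, shift_of, GrV.shift_add]; rfl
    ext a
    exact DFunLike.congr_fun this a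

/-- The `ℤ[x, x⁻¹]`-module structure of `K₀ᵍʳ`, with `xᵞ [P] = [P(γ)]`. -/
noncomputable instance : Module ℤ[T;T⁻¹] (GrK0 𝒜) :=
  Module.compHom (GrK0 𝒜)
    (AddMonoidAlgebra.lift ℤ (Module.End ℤ (GrK0 𝒜)) ℤ (shiftHom 𝒜)).toRingHom

lemma T_smul (γ : ℤ) (a : GrK0 𝒜) : (LaurentPolynomial.T γ : ℤ[T;T⁻¹]) • a = shift 𝒜 γ a := by
  change (AddMonoidAlgebra.lift ℤ (Module.End ℤ (GrK0 𝒜)) ℤ (shiftHom 𝒜))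
    (LaurentPolynomial.T γ) a = _
  rw [LaurentPolynomial.T, AddMonoidAlgebra.lift_single, one_smul]
  rfl

end GrK0

end Graded

/-! ### Krieger's dimension group -/

section Krieger

variable {V : Type v} [Fintype V] (M : Matrix V V ℤ)

/-- The transition maps `ℤⱽ → ℤⱽ`, `a ↦ M ^ (j - i) a`, of the stationary system of `M`. -/
def kriegerMap (i j : ℕ) (_ : i ≤ j) : (V → ℤ) →ₗ[ℤ] (V → ℤ) := M.mulVecLin ^ (j - i)

instance : DirectedSystem (fun _ : ℕ => V → ℤ) (fun i j h => kriegerMap M i j h) where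
  map_self _ _ := by simp [kriegerMap]
  map_map k j i hij hjk x := by
    simp only [kriegerMap, ← Module.End.mul_apply, ← pow_add]
    congr 2
    omega

/-- The dimension group `Δ_M`: the direct limit of `ℤⱽ → ℤⱽ → ℤⱽ → ⋯` with all maps given by
multiplication by `M` from the left. -/
def DimGroup : Type v := Module.DirectLimit (R := ℤ) (fun _ : ℕ => V → ℤ) (kriegerMap M)

namespace DimGroup

noncomputable instance : AddCommGroup (DimGroup M) :=
  inferInstanceAs (AddCommGroup (Module.DirectLimit (R := ℤ) (fun _ : ℕ => V → ℤ) (kriegerMap M)))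

/-- The class `[a, k]` of `a` in the `k`-th copy of `ℤⱽ`. -/
noncomputable def of (k : ℕ) : (V → ℤ) →ₗ[ℤ] DimGroup M :=
  Module.DirectLimit.of ℤ ℕ (fun _ : ℕ => V → ℤ) (kriegerMap M) k

/-- The positive cone: the classes `[a, k]` of nonnegative vectors `a`. -/
def cone : Set (DimGroup M) := {z | ∃ (k : ℕ) (a : V → ℤ), 0 ≤ a ∧ of M k a = z}

lemma of_succ (k : ℕ) (a : V → ℤ) : of M (k + 1) (M.mulVec a) = of M k a := by
  have h := Module.DirectLimit.of_f (R := ℤ) (G := fun _ : ℕ => V → ℤ) (f := kriegerMap M)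
    (hij := Nat.le_succ k) (x := a)
  rw [kriegerMap, Nat.succ_eq_add_one, Nat.add_sub_cancel_left, pow_one] at h
  exact h

lemma hom_ext {f g : DimGroup M →ₗ[ℤ] DimGroup M} (h : ∀ k a, f (of M k a) = g (of M k a)) :
    f = g :=
  Module.DirectLimit.hom_ext fun k => LinearMap.ext (h k)

/-- The endomorphism `[a, k] ↦ [M a, k]`. -/
noncomputable def mulHom : DimGroup M →ₗ[ℤ] DimGroup M :=
  Module.DirectLimit.lift ℤ ℕ (fun _ : ℕ => V → ℤ) (kriegerMap M)
    (fun k => (of M k).comp M.mulVecLin) fun i j hij x => by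
      change of M j (M.mulVecLin ((M.mulVecLin ^ (j - i)) x)) = of M i (M.mulVecLin x)
      rw [← Module.End.mul_apply, ← pow_succ', pow_succ, Module.End.mul_apply]
      exact Module.DirectLimit.of_f (R := ℤ) (f := kriegerMap M) (hij := hij)

/-- The endomorphism `[a, k] ↦ [a, k + 1]`. -/
noncomputable def shiftHom : DimGroup M →ₗ[ℤ] DimGroup M :=
  Module.DirectLimit.lift ℤ ℕ (fun _ : ℕ => V → ℤ) (kriegerMap M)
    (fun k => of M (k + 1)) fun i j hij x => by
      have h := Module.DirectLimit.of_f (R := ℤ) (G := fun _ : ℕ => V → ℤ) (f := kriegerMap M)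
        (hij := Nat.succ_le_succ hij) (x := x)
      rw [kriegerMap, Nat.succ_sub_succ] at h
      exact h

lemma mulHom_of (k : ℕ) (a : V → ℤ) : mulHom M (of M k a) = of M k (M.mulVec a) :=
  Module.DirectLimit.lift_of _ _ _

lemma shiftHom_of (k : ℕ) (a : V → ℤ) : shiftHom M (of M k a) = of M (k + 1) a :=
  Module.DirectLimit.lift_of _ _ _

/-- The automorphism `δ_M` of the dimension group, `[a, k] ↦ [M a, k]`; its inverse is
`[a, k] ↦ [a, k + 1]`. -/
noncomputable def delta : DimGroup M ≃+ DimGroup M :=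
  (LinearEquiv.ofLinearMap (mulHom M) (shiftHom M)
    (hom_ext M fun k a => by
      rw [LinearMap.comp_apply, shiftHom_of, mulHom_of, of_succ]; rfl)
    (hom_ext M fun k a => by
      rw [LinearMap.comp_apply, mulHom_of, shiftHom_of, of_succ]; rfl)).toAddEquiv

end DimGroup

end Krieger

/-! A graded finitely generated projective module P turns out to be a finite direct sum of modules
`v L(E)` with generators v placed in one common degree k ≥ 0. If a counts the summands by vertex, P
is sent to [a,k]. `HasRank P k a` records such a description by an orthogonal dual basis of degree k
with members labelled by vertices. The relation v = ∑ αα* replaces a generator at v by one generator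
of degree k + 1 at r(α) for each edge α leaving v, so (k,a) becomes (k + 1, Aᵗa), in agreement with
the direct limit.

Both existence and uniqueness rest on the degree-zero part of the algebra being locally matricial:
for a homogeneous x of degree 0 and all large n, every α*xβ with α, β paths of length n is a
combination of vertices (`eventually_mem_bilevel`). The degree-zero matrices attached to dual bases
therefore become matrices over K after enough expansions. For existence (`exists_isOrtho`), a
homogeneous dual basis is moved into one degree and expanded until its matrix is scalar; linear
relations over K then remove redundant members until the matrix is the identity. For uniqueness
(`exists_pow_mulVec_eq`), the transition matrices between two orthogonal bases of the same degree
become mutually inverse over K, vertex by vertex, so the counts agree after applying a power of Aᵗ.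
That vertices are nonzero is seen on functions of infinite paths (`vtx_ne_zero`).

Modules with equal rank data are graded isomorphic (`HasRank.grIso`), and every nonnegative vector
is a rank. Hence the graded monoid embeds in the dimension group with image the positive cone
(`dimHom_injective`, `range_dimHom`). The embedding extends to the group completion and stays
injective; it is onto because integer vectors are differences of nonnegative ones. Expanding once
and then shifting by 1 turns (k,a) into (k, Aᵗa), which gives the equivariance (`dimHom_shift`). -/

/-! ### Relations among the generators. -/

namespace LeavittPathAlgebra

open LeavittGen MulOpposite

variable {K : Type u} [Field K] {V : Type v} {W : Type w} [Fintype V] [Fintype W]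
  (E : DirectedGraph V W)

variable (K) in
/-- The idempotent of a vertex. -/
noncomputable def vtx (x : V) : LeavittPathAlgebra K E := gen K E (vertex x)

variable (K) in
/-- The element of an edge. -/
noncomputable def edg (e : W) : LeavittPathAlgebra K E := gen K E (edge e)

variable (K) in
/-- The element of a ghost edge. -/
noncomputable def gst (e : W) : LeavittPathAlgebra K E := gen K E (ghost e)

lemma vtx_mem (x : V) : vtx K E x ∈ grading K E 0 := gen_mem K E (vertex x)

lemma edg_mem (e : W) : edg K E e ∈ grading K E 1 := gen_mem K E (edge e)

lemma gst_mem (e : W) : gst K E e ∈ grading K E (-1) := gen_mem K E (ghost e)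

lemma sum_vtx : ∑ x : V, vtx K E x = 1 := by
  simpa [vtx, gen] using mk_eq K E LeavittRel.one

lemma vtx_mul_self (x : V) : vtx K E x * vtx K E x = vtx K E x := by
  simpa [vtx, gen] using mk_eq K E (LeavittRel.vertex_mul_vertex x x)

lemma vtx_mul_vtx_of_ne {x y : V} (h : x ≠ y) : vtx K E x * vtx K E y = 0 := by
  simpa [vtx, gen, h] using mk_eq K E (LeavittRel.vertex_mul_vertex x y)

lemma vtx_mul_edg (e : W) : vtx K E (E.s e) * edg K E e = edg K E e := by
  simpa [vtx, edg, gen] using mk_eq K E (LeavittRel.source_mul_edge e)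

lemma edg_mul_vtx (e : W) : edg K E e * vtx K E (E.r e) = edg K E e := by
  simpa [vtx, edg, gen] using mk_eq K E (LeavittRel.edge_mul_range e)

lemma vtx_mul_gst (e : W) : vtx K E (E.r e) * gst K E e = gst K E e := by
  simpa [vtx, gst, gen] using mk_eq K E (LeavittRel.range_mul_ghost e)

lemma gst_mul_vtx (e : W) : gst K E e * vtx K E (E.s e) = gst K E e := by
  simpa [vtx, gst, gen] using mk_eq K E (LeavittRel.ghost_mul_source e)

lemma gst_mul_edg_self (e : W) : gst K E e * edg K E e = vtx K E (E.r e) := by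
  simpa [vtx, gst, edg, gen] using mk_eq K E (LeavittRel.ghost_mul_edge e e)

lemma gst_mul_edg_of_ne {e f : W} (h : e ≠ f) : gst K E e * edg K E f = 0 := by
  simpa [vtx, gst, edg, gen, h] using mk_eq K E (LeavittRel.ghost_mul_edge e f)

lemma sum_edg_mul_gst_of_source (hE : E.NoSinks) (x : V) [Fintype {e : W // E.s e = x}] :
    ∑ e : {e : W // E.s e = x}, edg K E e * gst K E e = vtx K E x := by
  classical
  have h := mk_eq K E (LeavittRel.sum_edge_mul_ghost x (hE x))
  simp only [map_sum, map_mul] at h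
  rw [← Finset.sum_subtype_eq_sum_filter, Finset.subtype_univ] at h
  exact (Finset.sum_congr (by ext; simp) fun _ _ => rfl).trans h

lemma gst_mul_vtx_of_ne {e : W} {x : V} (h : E.s e ≠ x) : gst K E e * vtx K E x = 0 := by
  rw [← gst_mul_vtx, mul_assoc, vtx_mul_vtx_of_ne E h, mul_zero]

lemma sum_edg_mul_gst (hE : E.NoSinks) : ∑ e : W, edg K E e * gst K E e = 1 := by
  classical
  rw [← sum_vtx, ← Finset.sum_fiberwise (g := E.s)]
  refine Finset.sum_congr rfl fun x _ => ?_
  rw [← sum_edg_mul_gst_of_source E hE x, ← Finset.sum_subtype_eq_sum_filter,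
    Finset.subtype_univ]

/-! ### Local matricial structure of the degree-zero component. -/

variable (K) in
/-- The elements `x` for which all products `α* x β`, with `α` and `β` paths of lengths `m` and
`n`, are linear combinations of vertices. -/
noncomputable def bilevel : ℕ → ℕ → Submodule K (LeavittPathAlgebra K E)
  | 0, 0 => Submodule.span K (Set.range (vtx K E))
  | 0, n + 1 => ⨅ e : W, (bilevel 0 n).comap (LinearMap.mulRight K (edg K E e))
  | m + 1, n => ⨅ e : W, (bilevel m n).comap (LinearMap.mulLeft K (gst K E e))

variable {E}

lemma mem_bilevel_zero_succ {n : ℕ} {a : LeavittPathAlgebra K E} :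
    a ∈ bilevel K E 0 (n + 1) ↔ ∀ e, a * edg K E e ∈ bilevel K E 0 n := by
  simp [bilevel]

lemma mem_bilevel_succ_left {m n : ℕ} {a : LeavittPathAlgebra K E} :
    a ∈ bilevel K E (m + 1) n ↔ ∀ e, gst K E e * a ∈ bilevel K E m n := by
  simp [bilevel]

/-- The recursive definition strips all ghost edges before any edge; the order is immaterial because
left and right multiplications commute. -/
lemma mem_bilevel_succ_right {m n : ℕ} {a : LeavittPathAlgebra K E} :
    a ∈ bilevel K E m (n + 1) ↔ ∀ e, a * edg K E e ∈ bilevel K E m n := by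
  induction m generalizing a with
  | zero => exact mem_bilevel_zero_succ
  | succ m ih =>
    simp only [mem_bilevel_succ_left, ih, mul_assoc]
    exact forall_comm

lemma mem_bilevel_succ_succ {m n : ℕ} {a : LeavittPathAlgebra K E} :
    a ∈ bilevel K E (m + 1) (n + 1) ↔
      ∀ e f, gst K E e * (a * edg K E f) ∈ bilevel K E m n := by
  simp only [mem_bilevel_succ_left, mem_bilevel_succ_right, mul_assoc]

/-- The vertices are orthogonal idempotents, so multiplication by one of them on either side
extracts its coefficient. -/
lemma exists_vtx_mul_eq {a : LeavittPathAlgebra K E} (ha : a ∈ bilevel K E 0 0) :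
    ∃ c : V → K, ∀ x, vtx K E x * a = c x • vtx K E x ∧ a * vtx K E x = c x • vtx K E x := by
  classical
  rw [bilevel] at ha
  induction ha using Submodule.span_induction with
  | mem a h =>
    obtain ⟨y, rfl⟩ := h
    refine ⟨Pi.single y 1, fun x => ?_⟩
    rcases eq_or_ne x y with rfl | h
    · simp [vtx_mul_self]
    · simp [vtx_mul_vtx_of_ne E h, vtx_mul_vtx_of_ne E h.symm, h]
  | zero => exact ⟨0, by simp⟩
  | add a b _ _ iha ihb =>
    obtain ⟨c, hc⟩ := iha
    obtain ⟨d, hd⟩ := ihb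
    exact ⟨c + d, fun x => by simp [mul_add, add_mul, hc, hd, add_smul]⟩
  | smul t a _ ih =>
    obtain ⟨c, hc⟩ := ih
    exact ⟨t • c, fun x => by simp [hc, mul_smul]⟩

lemma vtx_mul_mem_bilevel {m n : ℕ} {a : LeavittPathAlgebra K E} (ha : a ∈ bilevel K E m n)
    (x : V) : vtx K E x * a ∈ bilevel K E m n := by
  cases m with
  | zero =>
    induction n generalizing a with
    | zero =>
      obtain ⟨c, hc⟩ := exists_vtx_mul_eq ha
      rw [(hc x).1, bilevel]
      exact Submodule.smul_mem _ _ (Submodule.subset_span ⟨x, rfl⟩)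
    | succ n ih =>
      rw [mem_bilevel_succ_right] at ha ⊢
      exact fun e => mul_assoc (vtx K E x) a _ ▸ ih (ha e)
  | succ m =>
    rw [mem_bilevel_succ_left] at ha ⊢
    intro e
    rw [← mul_assoc]
    by_cases h : E.s e = x
    · rw [← h, gst_mul_vtx]
      exact ha e
    · rw [gst_mul_vtx_of_ne E h, zero_mul]
      exact zero_mem _

lemma one_mem_bilevel (m : ℕ) : (1 : LeavittPathAlgebra K E) ∈ bilevel K E m m := by
  induction m with
  | zero =>
    rw [← sum_vtx, bilevel]
    exact sum_mem fun x _ => Submodule.subset_span ⟨x, rfl⟩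
  | succ m ih =>
    rw [mem_bilevel_succ_succ]
    intro e f
    rw [one_mul]
    rcases eq_or_ne e f with rfl | h
    · rw [gst_mul_edg_self]
      simpa using vtx_mul_mem_bilevel ih (E.r e)
    · rw [gst_mul_edg_of_ne E h]
      exact zero_mem _

/-- The word is consumed from the left: an initial edge cancels against a ghost edge and lowers m,
while an initial ghost edge supplies one of the m + 1 ghosts required by the rest. The length bound
keeps m positive whenever an edge has to be cancelled. -/
lemma prod_mem_bilevel (l : List (LeavittGen V W)) (m n : ℕ)
    (h : (m : ℤ) = n + (l.map LeavittGen.deg).sum) (hl : l.length ≤ m) :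
    (l.map (gen K E)).prod ∈ bilevel K E m n := by
  induction l generalizing m with
  | nil =>
    obtain rfl : m = n := by simpa using h
    simpa using one_mem_bilevel m
  | cons g l ih =>
    simp only [List.map_cons, List.prod_cons, List.sum_cons, List.length_cons] at h hl ⊢
    cases g with
    | vertex x => exact vtx_mul_mem_bilevel (ih m (by simpa [LeavittGen.deg] using h) (by omega)) x
    | edge e =>
      obtain ⟨m, rfl⟩ : ∃ k, m = k + 1 := ⟨m - 1, by omega⟩
      have key := ih m (by simp [LeavittGen.deg] at h; omega) (by omega)
      rw [mem_bilevel_succ_left]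
      intro f
      rw [← mul_assoc]
      rcases eq_or_ne f e with rfl | hf
      · rw [← edg, gst_mul_edg_self]
        exact vtx_mul_mem_bilevel key _
      · rw [← edg, gst_mul_edg_of_ne E hf, zero_mul]
        exact zero_mem _
    | ghost e =>
      have key := ih (m + 1) (by simp [LeavittGen.deg] at h; push_cast; omega) (by omega)
      exact mem_bilevel_succ_left.1 key e

/-- Stating this for all large m, and not for some m, lets finitely many elements share one level.
-/
lemma eventually_mem_bilevel {a : LeavittPathAlgebra K E} (ha : a ∈ grading K E 0) :
    ∀ᶠ m in Filter.atTop, a ∈ bilevel K E m m := by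
  rw [grading] at ha
  induction ha using Submodule.span_induction with
  | mem a h =>
    obtain ⟨l, hl, rfl⟩ := h
    filter_upwards [Filter.eventually_ge_atTop l.length] with m hm
    exact prod_mem_bilevel l m m (by simp [hl]) hm
  | zero => exact Filter.Eventually.of_forall fun m => zero_mem _
  | add a b _ _ iha ihb => exact (iha.and ihb).mono fun m h => add_mem h.1 h.2
  | smul t a _ ih => exact ih.mono fun m h => Submodule.smul_mem _ _ h

end LeavittPathAlgebra

/-! ### Infinite paths and the nonvanishing of vertices. -/

namespace DirectedGraph

variable {V : Type v} {W : Type w}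

/-- The infinite paths of a directed graph. -/
def InfPath (E : DirectedGraph V W) : Type w :=
  {p : ℕ → W // ∀ n, E.r (p n) = E.s (p (n + 1))}

namespace InfPath

variable {E : DirectedGraph V W}

/-- The first edge of an infinite path. -/
def head (p : E.InfPath) : W := p.1 0

/-- The infinite path without its first edge. -/
def tail (p : E.InfPath) : E.InfPath := ⟨fun n => p.1 (n + 1), fun n => p.2 (n + 1)⟩

/-- The extension of an infinite path by an edge. -/
def cons (e : W) (p : E.InfPath) (h : E.r e = E.s p.head) : E.InfPath :=
  ⟨fun n => Nat.casesOn n e p.1, fun n => by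
    cases n with
    | zero => exact h
    | succ n => exact p.2 n⟩

lemma head_cons (e : W) (p : E.InfPath) (h : E.r e = E.s p.head) : (cons e p h).head = e := rfl

lemma tail_cons (e : W) (p : E.InfPath) (h : E.r e = E.s p.head) : (cons e p h).tail = p := rfl

lemma range_head (p : E.InfPath) : E.r p.head = E.s p.tail.head := p.2 0

lemma cons_tail (e : W) (p : E.InfPath) (h : E.r e = E.s p.tail.head) (he : p.head = e) :
    cons e p.tail h = p := by
  subst he
  apply Subtype.ext
  funext n
  cases n <;> rfl

end InfPath

lemma NoSinks.exists_infPath {E : DirectedGraph V W} (hE : E.NoSinks) (x : V) :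
    ∃ p : E.InfPath, E.s p.head = x := by
  choose g hg using hE
  refine ⟨⟨fun n => (fun e => g (E.r e))^[n] (g x), fun n => ?_⟩, hg x⟩
  simp only [Function.iterate_succ_apply', hg]

end DirectedGraph

namespace LeavittPathAlgebra

open LeavittGen DirectedGraph

variable (K : Type u) [Field K] {V : Type v} {W : Type w}
  (E : DirectedGraph V W)

open Classical in
/-- The action of the generators of the Leavitt path algebra on functions of infinite paths. -/
noncomputable def pathRepGen : LeavittGen V W → Module.End K (E.InfPath → K)
  | vertex x =>
    { toFun := fun g p => if E.s p.head = x then g p else 0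
      map_add' := fun g h => by funext p; simp only [Pi.add_apply]; split_ifs <;> simp
      map_smul' := fun c g => by funext p; simp }
  | edge e =>
    { toFun := fun g p => if p.head = e then g p.tail else 0
      map_add' := fun g h => by funext p; simp only [Pi.add_apply]; split_ifs <;> simp
      map_smul' := fun c g => by funext p; simp }
  | ghost e =>
    { toFun := fun g p => if h : E.r e = E.s p.head then g (.cons e p h) else 0
      map_add' := fun g h => by funext p; simp only [Pi.add_apply]; split_ifs <;> simp
      map_smul' := fun c g => by
        funext p; simp only [Pi.smul_apply, RingHom.id_apply]; split_ifs <;> simp }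

open Classical in
lemma pathRepGen_vertex_apply (x : V) (g : E.InfPath → K) (p : E.InfPath) :
    pathRepGen K E (vertex x) g p = if E.s p.head = x then g p else 0 := rfl

open Classical in
lemma pathRepGen_edge_apply (e : W) (g : E.InfPath → K) (p : E.InfPath) :
    pathRepGen K E (edge e) g p = if p.head = e then g p.tail else 0 := rfl

open Classical in
lemma pathRepGen_ghost_apply (e : W) (g : E.InfPath → K) (p : E.InfPath) :
    pathRepGen K E (ghost e) g p = if h : E.r e = E.s p.head then g (.cons e p h) else 0 := rfl

variable [Fintype V] [Fintype W]

/-- The relation v = ∑ αα* holds because an infinite path has exactly one first edge; it would fail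
on finite paths, at those of length zero. -/
lemma pathRepGen_rel ⦃a b : FreeAlgebra K (LeavittGen V W)⦄ (h : LeavittRel K E a b) :
    FreeAlgebra.lift K (pathRepGen K E) a = FreeAlgebra.lift K (pathRepGen K E) b := by
  classical
  refine LinearMap.ext fun g => funext fun p => ?_
  cases h with
  | one =>
    simp [FreeAlgebra.lift_ι_apply, pathRepGen_vertex_apply]
  | vertex_mul_vertex x y =>
    simp only [map_mul, FreeAlgebra.lift_ι_apply, Module.End.mul_apply, pathRepGen_vertex_apply]
    rcases eq_or_ne x y with rfl | hxy
    · by_cases h : E.s p.head = x <;> simp [pathRepGen_vertex_apply, h]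
    · simp only [if_neg hxy, map_zero, LinearMap.zero_apply, Pi.zero_apply]
      split_ifs with h1 h2
      · exact absurd (h1.symm.trans h2) hxy
      · rfl
      · rfl
  | source_mul_edge e =>
    simp only [map_mul, FreeAlgebra.lift_ι_apply, Module.End.mul_apply, pathRepGen_vertex_apply,
      pathRepGen_edge_apply]
    split_ifs with h1 h2 h3
    · rfl
    · rfl
    · exact absurd (by rw [h3]) h1
    · rfl
  | edge_mul_range e =>
    simp only [map_mul, FreeAlgebra.lift_ι_apply, Module.End.mul_apply, pathRepGen_vertex_apply,
      pathRepGen_edge_apply]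
    split_ifs with h1 h2
    · rfl
    · exact absurd (by rw [← h1, p.range_head]) h2
    · rfl
  | range_mul_ghost e =>
    simp only [map_mul, FreeAlgebra.lift_ι_apply, Module.End.mul_apply, pathRepGen_vertex_apply,
      pathRepGen_ghost_apply]
    split_ifs with h1 h2 h3
    · rfl
    · rfl
    · exact absurd h3.symm h1
    · rfl
  | ghost_mul_source e =>
    simp only [map_mul, FreeAlgebra.lift_ι_apply, Module.End.mul_apply, pathRepGen_vertex_apply,
      pathRepGen_ghost_apply, InfPath.head_cons, if_true]
  | ghost_mul_edge e f =>
    simp only [map_mul, FreeAlgebra.lift_ι_apply, Module.End.mul_apply, pathRepGen_edge_apply,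
      pathRepGen_ghost_apply, InfPath.head_cons, InfPath.tail_cons]
    rcases eq_or_ne e f with rfl | hef
    · simp [pathRepGen_vertex_apply, eq_comm]
    · simp [hef]
  | sum_edge_mul_ghost x hx =>
    simp only [map_sum, map_mul, FreeAlgebra.lift_ι_apply, LinearMap.sum_apply, Finset.sum_apply,
      Module.End.mul_apply, pathRepGen_edge_apply, pathRepGen_ghost_apply,
      pathRepGen_vertex_apply]
    have : ∀ e : W, (if p.head = e then
        if h : E.r e = E.s p.tail.head then g (.cons e p.tail h) else 0 else 0) =
        if p.head = e then g p else 0 := by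
      intro e
      split_ifs with h1 h2
      · rw [InfPath.cons_tail e p h2 h1]
      · exact absurd (by rw [← h1, p.range_head]) h2
      · rfl
    simp [this, Finset.sum_ite_eq]

/-- The vertex acts by restricting functions to the paths starting at it, and without sinks there is
such a path. -/
lemma vtx_ne_zero {E : DirectedGraph V W} (hE : E.NoSinks) (x : V) : vtx K E x ≠ 0 := by
  intro h
  have h1 : RingQuot.liftAlgHom K ⟨FreeAlgebra.lift K (pathRepGen K E), pathRepGen_rel K E⟩
      (vtx K E x) = pathRepGen K E (vertex x) :=
    (RingQuot.liftAlgHom_mkAlgHom_apply K _ _ _).trans (FreeAlgebra.lift_ι_apply _ _)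
  obtain ⟨p, hp⟩ := hE.exists_infPath x
  have h2 : pathRepGen K E (vertex x) (fun _ => 1) p = 0 := by
    rw [← h1, h]
    exact congrFun (LinearMap.congr_fun (map_zero _) _) p
  simp [pathRepGen_vertex_apply, hp] at h2

end LeavittPathAlgebra

/-! ### Dual bases labelled by vertices: expansion, uniqueness and reduction. -/

namespace LeavittPathAlgebra

open LeavittGen DirectedGraph MulOpposite

variable {K : Type u} [Field K] {V : Type v} {W : Type w} [Fintype V] [Fintype W]
  {E : DirectedGraph V W}

/-- A dual basis, homogeneous of degree `k`, of a graded projective module over a Leavitt path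
algebra, whose members are labelled by vertices. -/
structure DualBasis (P : GrProjModule (grading K E)) (k : ℤ) {I : Type*} [Fintype I] (f : I → V)
    where
  vec : I → P.carrier
  coord : I → P.carrier →ₗ[(LeavittPathAlgebra K E)ᵐᵒᵖ] LeavittPathAlgebra K E
  vec_mem : ∀ i, vec i ∈ P.deg k
  coord_mem : ∀ i n x, x ∈ P.deg n → coord i x ∈ grading K E (n - k)
  vtx_smul_vec : ∀ i, op (vtx K E (f i)) • vec i = vec i
  vtx_mul_coord : ∀ i x, vtx K E (f i) * coord i x = coord i x
  sum_smul : ∀ x, ∑ i, op (coord i x) • vec i = x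

namespace DualBasis

variable {P : GrProjModule (grading K E)} {k : ℤ} {I J : Type w} [Fintype I] [Fintype J]
  {f : I → V} {g : J → V}

/-- The members are a basis with dual basis the coordinate functions. -/
def IsOrtho (B : DualBasis P k f) : Prop :=
  (∀ i, B.coord i (B.vec i) = vtx K E (f i)) ∧ ∀ i j, i ≠ j → B.coord i (B.vec j) = 0

lemma coord_smul (B : DualBasis P k f) (i : I) (a : LeavittPathAlgebra K E) (x : P.carrier) :
    B.coord i (op a • x) = B.coord i x * a := by
  rw [map_smul, op_smul_eq_mul]

lemma coord_vec_mul_vtx (B : DualBasis P k f) (C : DualBasis P k g) (i : I) (j : J) :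
    B.coord i (C.vec j) * vtx K E (g j) = B.coord i (C.vec j) := by
  rw [← coord_smul, C.vtx_smul_vec]

lemma coord_vec_mem (B : DualBasis P k f) (C : DualBasis P k g) (i : I) (j : J) :
    B.coord i (C.vec j) ∈ grading K E 0 := by
  simpa using B.coord_mem i k _ (C.vec_mem j)

lemma sum_mul_coord (B : DualBasis P k f)
    (c : P.carrier →ₗ[(LeavittPathAlgebra K E)ᵐᵒᵖ] LeavittPathAlgebra K E) (x : P.carrier) :
    ∑ i, c (B.vec i) * B.coord i x = c x := by
  conv_rhs => rw [← B.sum_smul x]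
  simp

/-- Relabelling along an equivalence. -/
def reindex {I J : Type*} [Fintype I] [Fintype J] {f : I → V} (B : DualBasis P k f)
    (e : J ≃ I) : DualBasis P k (f ∘ e) where
  vec j := B.vec (e j)
  coord j := B.coord (e j)
  vec_mem _ := B.vec_mem _
  coord_mem _ := B.coord_mem _
  vtx_smul_vec _ := B.vtx_smul_vec _
  vtx_mul_coord _ := B.vtx_mul_coord _
  sum_smul x := (e.sum_comp fun i => op (B.coord i x) • B.vec i).trans (B.sum_smul x)

lemma IsOrtho.reindex {B : DualBasis P k f} (hB : B.IsOrtho) (e : J ≃ I) :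
    (B.reindex e).IsOrtho :=
  ⟨fun j => hB.1 (e j), fun _ _ h => hB.2 _ _ (e.injective.ne h)⟩

/-- The edges which start at the label of a member of a family of vertices. -/
abbrev ExpandIndex (E : DirectedGraph V W) (f : I → V) : Type _ :=
  Σ i, {e : W // E.s e = f i}

open Classical in
noncomputable instance (E : DirectedGraph V W) (f : I → V) : Fintype (ExpandIndex E f) :=
  inferInstanceAs (Fintype (Σ i, {e : W // E.s e = f i}))

open Classical in
/-- The dual basis of the next degree which arises from the relations `v = ∑ α α*`. -/
noncomputable def expand (B : DualBasis P k f) (hE : E.NoSinks) :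
    DualBasis P (k + 1) (fun p : ExpandIndex E f => E.r p.2) where
  vec p := op (edg K E p.2) • B.vec p.1
  coord p := gst K E p.2 • B.coord p.1
  vec_mem p := P.smul_mem (B.vec_mem _) (edg_mem E _)
  coord_mem p n x hx := by
    have h := SetLike.mul_mem_graded (gst_mem (K := K) E p.2) (B.coord_mem p.1 n x hx)
    rw [show -1 + (n - k) = n - (k + 1) by ring] at h
    exact h
  vtx_smul_vec p := by rw [← mul_smul, ← op_mul, edg_mul_vtx]
  vtx_mul_coord p x := by
    rw [LinearMap.smul_apply, smul_eq_mul, ← mul_assoc, vtx_mul_gst]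
  sum_smul x := by
    refine (Fintype.sum_sigma _).trans ?_
    conv_rhs => rw [← B.sum_smul x]
    refine Finset.sum_congr rfl fun i _ => ?_
    simp only [LinearMap.smul_apply, smul_eq_mul, ← mul_smul, ← op_mul, ← mul_assoc]
    rw [← Finset.sum_smul, ← Finset.op_sum, ← Finset.sum_mul, sum_edg_mul_gst_of_source E hE,
      B.vtx_mul_coord]

/-- Expansion replaces a matrix entry x by the elements α*xβ, which is exactly what lowers both
indices of `bilevel` by one. -/
lemma expand_coord_vec (B : DualBasis P k f) (C : DualBasis P k g) (hE : E.NoSinks)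
    (p : ExpandIndex E f) (q : ExpandIndex E g) :
    (B.expand hE).coord p ((C.expand hE).vec q) =
      gst K E p.2 * (B.coord p.1 (C.vec q.1) * edg K E q.2) := by
  simp [expand, mul_assoc]

lemma IsOrtho.expand {B : DualBasis P k f} (hB : B.IsOrtho) (hE : E.NoSinks) :
    (B.expand hE).IsOrtho := by
  constructor
  · rintro ⟨i, e, he⟩
    rw [expand_coord_vec, hB.1]
    simp only
    rw [← he, vtx_mul_edg, gst_mul_edg_self]
  · rintro ⟨i, e, he⟩ ⟨j, e', he'⟩ h
    rw [expand_coord_vec]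
    rcases eq_or_ne i j with rfl | hij
    · simp only
      rw [hB.1, ← he', vtx_mul_edg, gst_mul_edg_of_ne]
      rintro rfl
      exact h rfl
    · rw [hB.2 _ _ hij, zero_mul, mul_zero]

/-- The transpose appears because new members are labelled by the ranges of edges and counted by the
labels at their sources. -/
lemma card_expandIndex (E : DirectedGraph V W) (f : I → V) (y : V) :
    (Nat.card {p : ExpandIndex E f // E.r p.2 = y} : ℤ) =
      E.adjMatrix.transpose.mulVec (fun x => (Nat.card {i // f i = x} : ℤ)) y := by
  classical
  have e : {p : ExpandIndex E f // E.r p.2 = y} ≃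
      Σ x : V, {e : W // E.s e = x ∧ E.r e = y} × {i // f i = x} :=
    { toFun := fun p => ⟨f p.1.1, ⟨p.1.2.1, p.1.2.2, p.2⟩, ⟨p.1.1, rfl⟩⟩
      invFun := fun q => ⟨⟨q.2.2.1, q.2.1.1, q.2.1.2.1.trans q.2.2.2.symm⟩, q.2.1.2.2⟩
      left_inv := fun _ => rfl
      right_inv := by rintro ⟨x, ⟨e, h⟩, ⟨i, rfl⟩⟩; rfl }
  rw [Nat.card_congr e, Nat.card_sigma]
  simp [Matrix.mulVec, dotProduct, adjMatrix]

/-- The entry is fixed by the vertex `f i` on the left and by `g j` on the right, so only the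
coefficient of a common vertex can survive. -/
lemma exists_scalar (B : DualBasis P k f) (C : DualBasis P k g)
    (h : ∀ i j, B.coord i (C.vec j) ∈ bilevel K E 0 0) :
    ∃ c : I → J → K, ∀ i j, B.coord i (C.vec j) = c i j • vtx K E (f i) ∧
      (f i ≠ g j → c i j = 0) := by
  classical
  choose c hc using fun i j => exists_vtx_mul_eq (h i j)
  refine ⟨fun i j => if f i = g j then c i j (f i) else 0, fun i j => ⟨?_, fun h => if_neg h⟩⟩
  have h1 := (hc i j (f i)).1
  rw [B.vtx_mul_coord] at h1
  simp only
  split_ifs with hij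
  · exact h1
  · rw [← B.coord_vec_mul_vtx C, h1, smul_mul_assoc, vtx_mul_vtx_of_ne E hij, smul_zero, zero_smul]

open Classical in
lemma IsOrtho.scalar_mul_eq_one {B : DualBasis P k f} (hB : B.IsOrtho)
    {C : DualBasis P k g} (hE : E.NoSinks) {c : I → J → K} {d : J → I → K}
    (hc : ∀ i j, B.coord i (C.vec j) = c i j • vtx K E (f i) ∧ (f i ≠ g j → c i j = 0))
    (hd : ∀ j i, C.coord j (B.vec i) = d j i • vtx K E (g j) ∧ (g j ≠ f i → d j i = 0))
    (x : V) :
    (Matrix.of fun (i : {i // f i = x}) (j : {j // g j = x}) => c i j) *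
      (Matrix.of fun (j : {j // g j = x}) (i : {i // f i = x}) => d j i) = 1 := by
  ext ⟨i, hi⟩ ⟨i', hi'⟩
  -- Scalars may be compared after multiplying the vertex by them, since the vertex is nonzero. The
  -- identity needed is then B_i(C_j) C_j(B_i') summed over j, which equals B_i(B_i').
  apply smul_left_injective K (vtx_ne_zero K hE x)
  have h1 := C.sum_mul_coord (B.coord i) (B.vec i')
  have h2 : ∀ j, B.coord i (C.vec j) * C.coord j (B.vec i') = (c i j * d j i') • vtx K E x := by
    intro j
    rw [(hc i j).1, (hd j i').1]
    by_cases h : g j = x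
    · rw [hi, h, smul_mul_smul_comm, vtx_mul_self]
    · rw [(hc i j).2 (by rw [hi]; exact Ne.symm h)]
      simp
  simp only [h2, ← Finset.sum_smul] at h1
  have h3 : ∑ j, c i j * d j i' = ∑ j : {j // g j = x}, c i j * d j i' := by
    rw [← Finset.sum_filter_add_sum_filter_not Finset.univ (fun j => g j = x),
      ← Finset.sum_subtype_eq_sum_filter, Finset.subtype_univ, add_eq_left]
    refine Finset.sum_eq_zero fun j hj => ?_
    rw [(hc i j).2 (by rw [hi]; exact Ne.symm (Finset.mem_filter.1 hj).2), zero_mul]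
  simp only [Matrix.mul_apply, Matrix.of_apply, Matrix.one_apply, Subtype.mk.injEq]
  rw [← h3, h1]
  split_ifs with h
  · subst h
    rw [hB.1, hi, one_smul]
  · rw [hB.2 _ _ h, zero_smul]

/-- The blocks of the two transition matrices at x are mutually inverse over K, hence square. -/
lemma IsOrtho.card_eq {B : DualBasis P k f} (hB : B.IsOrtho) {C : DualBasis P k g}
    (hC : C.IsOrtho) (hE : E.NoSinks) (h : ∀ i j, B.coord i (C.vec j) ∈ bilevel K E 0 0)
    (h' : ∀ j i, C.coord j (B.vec i) ∈ bilevel K E 0 0) (x : V) :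
    Nat.card {i // f i = x} = Nat.card {j // g j = x} := by
  classical
  obtain ⟨c, hc⟩ := exists_scalar B C h
  obtain ⟨d, hd⟩ := exists_scalar C B h'
  rw [Nat.card_eq_fintype_card, Nat.card_eq_fintype_card]
  exact card_eq_of_linearEquiv K (Matrix.toLin'OfInv (hB.scalar_mul_eq_one hE hc hd x)
    (hC.scalar_mul_eq_one hE hd hc x))

lemma IsOrtho.pow_mulVec_eq_of_mem_bilevel {B : DualBasis P k f} (hB : B.IsOrtho) {C : DualBasis P k g}
    (hC : C.IsOrtho) (hE : E.NoSinks) {n : ℕ}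
    (h : ∀ i j, B.coord i (C.vec j) ∈ bilevel K E n n)
    (h' : ∀ j i, C.coord j (B.vec i) ∈ bilevel K E n n) :
    (E.adjMatrix.transpose.mulVecLin ^ n) (fun x => (Nat.card {i // f i = x} : ℤ)) =
      (E.adjMatrix.transpose.mulVecLin ^ n) (fun x => (Nat.card {j // g j = x} : ℤ)) := by
  classical
  induction n generalizing I J k with
  | zero =>
    funext x
    simpa using hB.card_eq hC hE h h' x
  | succ n ih =>
    have key := ih (hB.expand hE) (hC.expand hE)
      (fun p q => by
        rw [expand_coord_vec]
        exact mem_bilevel_succ_succ.1 (h p.1 q.1) p.2 q.2)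
      (fun p q => by
        rw [expand_coord_vec]
        exact mem_bilevel_succ_succ.1 (h' p.1 q.1) p.2 q.2)
    simp only [card_expandIndex] at key
    simp only [pow_succ, Module.End.mul_apply]
    exact key

lemma eventually_coord_mem_bilevel (B : DualBasis P k f) (C : DualBasis P k g) :
    ∀ᶠ n in Filter.atTop, ∀ i j, B.coord i (C.vec j) ∈ bilevel K E n n := by
  simp only [Filter.eventually_all]
  exact fun i j => eventually_mem_bilevel (B.coord_vec_mem C i j)

lemma IsOrtho.exists_pow_mulVec_eq {B : DualBasis P k f} (hB : B.IsOrtho) {C : DualBasis P k g}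
    (hC : C.IsOrtho) (hE : E.NoSinks) : ∃ n : ℕ,
    (E.adjMatrix.transpose.mulVecLin ^ n) (fun x => (Nat.card {i // f i = x} : ℤ)) =
      (E.adjMatrix.transpose.mulVecLin ^ n) (fun x => (Nat.card {j // g j = x} : ℤ)) := by
  obtain ⟨n, h1, h2⟩ := ((eventually_coord_mem_bilevel B C).and (eventually_coord_mem_bilevel C B)).exists
  exact ⟨n, hB.pow_mulVec_eq_of_mem_bilevel hC hE h1 h2⟩

/-- Removal of a redundant member. -/
noncomputable def remove [DecidableEq I] (B : DualBasis P k f) (i : I) (t : {l // l ≠ i} → K)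
    (ht : ∀ l : {l // l ≠ i}, f l ≠ f i → t l = 0)
    (hi : ∑ l : {l // l ≠ i}, op (t l • vtx K E (f i)) • B.vec l = B.vec i) :
    DualBasis P k (fun l : {l // l ≠ i} => f l) where
  vec l := B.vec l
  -- This is the coordinate obtained by substituting the expression for `vec i` into the expansion
  -- of an element; `ht` ensures that the correction carries the label `f l`.
  coord l := B.coord l + (t l • vtx K E (f i)) • B.coord i
  vec_mem l := B.vec_mem l
  coord_mem l n x hx := by
    have h : ((t l • vtx K E (f i)) • B.coord i) x = t l • B.coord i x := by
      rw [LinearMap.smul_apply, smul_eq_mul, smul_mul_assoc, B.vtx_mul_coord]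
    rw [LinearMap.add_apply, h]
    refine add_mem (B.coord_mem l n x hx) ?_
    exact Submodule.smul_mem _ _ (B.coord_mem i n x hx)
  vtx_smul_vec l := B.vtx_smul_vec l
  vtx_mul_coord l x := by
    simp only [LinearMap.add_apply, LinearMap.smul_apply, smul_eq_mul, mul_add, B.vtx_mul_coord,
      smul_mul_assoc, mul_smul_comm]
    by_cases h : f l = f i
    · rw [h, B.vtx_mul_coord]
    · simp [ht l h]
  sum_smul x := by
    conv_rhs => rw [← B.sum_smul x, ← Finset.add_sum_erase _ _ (Finset.mem_univ i)]
    have h1 : op (B.coord i x) • B.vec i =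
        ∑ l : {l // l ≠ i}, op ((t l • vtx K E (f i)) * B.coord i x) • B.vec l := by
      conv_lhs => rw [← hi, Finset.smul_sum]
      simp only [op_mul, mul_smul]
    have h2 : ∑ l ∈ Finset.univ.erase i, op (B.coord l x) • B.vec l =
        ∑ l : {l // l ≠ i}, op (B.coord l x) • B.vec l := by
      apply Finset.sum_subtype
      simp
    rw [h1, h2, ← Finset.sum_add_distrib]
    simp only [LinearMap.add_apply, LinearMap.smul_apply, smul_eq_mul, op_add, add_smul]
    exact Finset.sum_congr rfl fun l _ => add_comm _ _

end DualBasis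

end LeavittPathAlgebra

/-! ### Homogeneous dual bases over a graded algebra. -/

namespace GrProjModule

open MulOpposite

variable {K : Type v} {A : Type u} [CommRing K] [Ring A] [Algebra K A]
  {𝒜 : ℤ → Submodule K A} [GradedAlgebra 𝒜]

noncomputable instance (P : GrProjModule 𝒜) : DirectSum.Decomposition P.deg :=
  P.isInternal.chooseDecomposition

lemma exists_homogeneous_generators (P : GrProjModule 𝒜) :
    ∃ (m : ℕ) (d : Fin m → ℤ) (x : Fin m → P.carrier), (∀ i, x i ∈ P.deg (d i)) ∧
      Submodule.span Aᵐᵒᵖ (Set.range x) = ⊤ := by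
  have h1 : Submodule.span Aᵐᵒᵖ {x : P.carrier | ∃ n, x ∈ P.deg n} = ⊤ := by
    refine Submodule.eq_top_iff'.2 fun x => ?_
    induction x using DirectSum.Decomposition.inductionOn P.deg with
    | zero => exact zero_mem _
    | homogeneous x => exact Submodule.subset_span ⟨_, x.2⟩
    | add x y hx hy => exact add_mem hx hy
  have h2 : (⊤ : Submodule Aᵐᵒᵖ P.carrier).FG := P.finite.fg_top
  rw [← h1, Submodule.fg_span_iff_fg_span_finset_subset] at h2
  obtain ⟨S, hS, h⟩ := h2
  choose d hd using fun x : S => hS x.2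
  refine ⟨S.card, fun i => d (S.equivFin.symm i), fun i => S.equivFin.symm i, fun i => hd _, ?_⟩
  rw [← h1, h]
  congr 1
  ext x
  simp only [Set.mem_range, Finset.mem_coe]
  exact ⟨by rintro ⟨i, rfl⟩; exact (S.equivFin.symm i).2,
    fun hx => ⟨S.equivFin ⟨x, hx⟩, by simp⟩⟩

/-- The component of degree `-d` of a linear form. -/
noncomputable def homCoordAux (P : GrProjModule 𝒜) (c : P.carrier →ₗ[Aᵐᵒᵖ] A) (d : ℤ) :
    P.carrier →+ A :=
  (DirectSum.toAddMonoid fun n => (GradedRing.proj 𝒜 (n - d)).comp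
    (c.toAddMonoidHom.comp (P.deg n).subtype)).comp
      (DirectSum.decomposeAddEquiv P.deg).toAddMonoidHom

lemma homCoordAux_of_mem (P : GrProjModule 𝒜) (c : P.carrier →ₗ[Aᵐᵒᵖ] A) (d : ℤ) {n : ℤ}
    {x : P.carrier} (hx : x ∈ P.deg n) :
    P.homCoordAux c d x = GradedRing.proj 𝒜 (n - d) (c x) := by
  simp only [homCoordAux, AddMonoidHom.comp_apply, AddEquiv.coe_toAddMonoidHom,
    DirectSum.decomposeAddEquiv_apply]
  rw [DirectSum.decompose_of_mem _ hx, DirectSum.toAddMonoid_of]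
  rfl

/-- The component of degree `-d` of a linear form, as a linear form. -/
noncomputable def homCoord (P : GrProjModule 𝒜) (c : P.carrier →ₗ[Aᵐᵒᵖ] A) (d : ℤ) :
    P.carrier →ₗ[Aᵐᵒᵖ] A where
  toFun := P.homCoordAux c d
  map_add' := map_add _
  map_smul' := by
    intro a x
    induction a using MulOpposite.rec' with | _ a
    simp only [RingHom.id_apply, op_smul_eq_mul]
    induction x using DirectSum.Decomposition.inductionOn P.deg with
    | zero => simp
    | add x y hx hy => rw [smul_add, map_add, hx, hy, map_add, add_mul]
    | @homogeneous n x =>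
      induction a using DirectSum.Decomposition.inductionOn 𝒜 with
      | zero => simp
      | add a b ha hb => rw [op_add, add_smul, map_add, ha, hb, mul_add]
      | @homogeneous j a =>
        rw [homCoordAux_of_mem P c d (P.smul_mem x.2 a.2), homCoordAux_of_mem P c d x.2, map_smul,
          op_smul_eq_mul, show n + j - d = (n - d) + j by ring]
        exact DirectSum.coe_decompose_mul_add_of_right_mem 𝒜 a.2

lemma homCoord_of_mem (P : GrProjModule 𝒜) (c : P.carrier →ₗ[Aᵐᵒᵖ] A) (d : ℤ) {n : ℤ}
    {x : P.carrier} (hx : x ∈ P.deg n) :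
    P.homCoord c d x = GradedRing.proj 𝒜 (n - d) (c x) :=
  P.homCoordAux_of_mem c d hx

lemma homCoord_mem (P : GrProjModule 𝒜) (c : P.carrier →ₗ[Aᵐᵒᵖ] A) (d : ℤ) {n : ℤ}
    {x : P.carrier} (hx : x ∈ P.deg n) : P.homCoord c d x ∈ 𝒜 (n - d) := by
  rw [homCoord_of_mem P c d hx]
  exact SetLike.coe_mem _

lemma coe_decompose_smul (P : GrProjModule 𝒜) {d : ℤ} {x : P.carrier} (hx : x ∈ P.deg d) (a : A)
    (n : ℤ) :
    (DirectSum.decompose P.deg (op a • x) n : P.carrier) =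
      op (GradedRing.proj 𝒜 (n - d) a) • x := by
  induction a using DirectSum.Decomposition.inductionOn 𝒜 with
  | zero => simp
  | add a b ha hb =>
    rw [op_add, add_smul, DirectSum.decompose_add, map_add, op_add, add_smul, ← ha, ← hb]
    rfl
  | @homogeneous j a =>
    have h := P.smul_mem hx a.2
    by_cases hn : d + j = n
    · subst hn
      rw [DirectSum.decompose_of_mem_same _ h, add_sub_cancel_left]
      congr 2
      exact (DirectSum.decompose_of_mem_same 𝒜 a.2).symm
    · rw [DirectSum.decompose_of_mem_ne _ h hn]
      have : GradedRing.proj 𝒜 (n - d) (a : A) = 0 :=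
        DirectSum.decompose_of_mem_ne 𝒜 a.2 fun h => hn (by omega)
      rw [this, op_zero, zero_smul]

/-- The homogeneous dual basis lemma. -/
lemma exists_homogeneous_dualBasis (P : GrProjModule 𝒜) :
    ∃ (m : ℕ) (d : Fin m → ℤ) (x : Fin m → P.carrier) (c : Fin m → P.carrier →ₗ[Aᵐᵒᵖ] A),
      (∀ i, x i ∈ P.deg (d i)) ∧ (∀ i n y, y ∈ P.deg n → c i y ∈ 𝒜 (n - d i)) ∧
        ∀ y, ∑ i, op (c i y) • x i = y := by
  obtain ⟨m, d, x, hx, hspan⟩ := P.exists_homogeneous_generators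
  let π : (Fin m → A) →ₗ[Aᵐᵒᵖ] P.carrier :=
    { toFun := fun c => ∑ i, op (c i) • x i
      map_add' := fun a b => by simp [add_smul, Finset.sum_add_distrib]
      map_smul' := fun a b => by
        induction a using MulOpposite.rec' with | _ a
        simp [mul_smul, Finset.smul_sum] }
  have hπ : Function.Surjective π := fun y => by
    have hy : y ∈ Submodule.span Aᵐᵒᵖ (Set.range x) := hspan ▸ Submodule.mem_top
    obtain ⟨c, hc⟩ := (Submodule.mem_span_range_iff_exists_fun _).1 hy
    exact ⟨fun i => unop (c i), hc⟩
  have := P.projective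
  obtain ⟨σ, hσ⟩ := Module.projective_lifting_property π LinearMap.id hπ
  let c : Fin m → P.carrier →ₗ[Aᵐᵒᵖ] A := fun i => (LinearMap.proj i).comp σ
  have hc : ∀ y, ∑ i, op (c i y) • x i = y := fun y => LinearMap.congr_fun hσ y
  -- The section `σ` need not respect degrees, so each coordinate is replaced by its component of
  -- degree `-d i`.
  refine ⟨m, d, x, fun i => P.homCoord (c i) (d i), hx,
    fun i n y hy => P.homCoord_mem _ _ hy, fun y => ?_⟩
  induction y using DirectSum.Decomposition.inductionOn P.deg with
  | zero => simp
  | add y z hy hz => simp only [map_add, op_add, add_smul, Finset.sum_add_distrib, hy, hz]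
  | @homogeneous n y =>
    -- For y of degree n, the degree-n part of the original expansion involves exactly the selected
    -- components of the coordinates.
    have h : (DirectSum.decompose P.deg (∑ i, op (c i y) • x i) n : P.carrier) = y := by
      rw [hc]
      exact DirectSum.decompose_of_mem_same _ y.2
    rw [DirectSum.decompose_sum, DFinsupp.finsetSum_apply, AddSubgroup.val_finsetSum] at h
    simp only [P.coe_decompose_smul (hx _)] at h
    simpa only [P.homCoord_of_mem _ _ y.2] using h

end GrProjModule

/-! ### Existence of orthogonal dual bases. -/

namespace LeavittPathAlgebra

open LeavittGen DirectedGraph MulOpposite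

variable {K : Type u} [Field K] {V : Type v} {W : Type w} [Fintype V] [Fintype W]
  {E : DirectedGraph V W}

/-- Iterating 1 = ∑ αα* over n edges gives the factors; they serve to raise the degree of a
generator by n. -/
lemma exists_sum_mul_eq_one (hE : E.NoSinks) (n : ℕ) :
    ∃ (Q : Type w) (_ : Fintype Q) (a b : Q → LeavittPathAlgebra K E),
      (∀ q, a q ∈ grading K E n) ∧ (∀ q, b q ∈ grading K E (-n)) ∧ ∑ q, a q * b q = 1 := by
  induction n with
  | zero =>
    exact ⟨PUnit, inferInstance, 1, 1, fun _ => by simpa using SetLike.one_mem_graded (grading K E),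
      fun _ => by simpa using SetLike.one_mem_graded (grading K E), by simp⟩
  | succ n ih =>
    obtain ⟨Q, _, a, b, ha, hb, hab⟩ := ih
    refine ⟨Q × W, inferInstance, fun p => a p.1 * edg K E p.2, fun p => gst K E p.2 * b p.1,
      fun p => ?_, fun p => ?_, ?_⟩
    · exact_mod_cast SetLike.mul_mem_graded (ha p.1) (edg_mem E p.2)
    · have h := SetLike.mul_mem_graded (gst_mem (K := K) E p.2) (hb p.1)
      rwa [show -1 + -(n : ℤ) = -((n + 1 : ℕ) : ℤ) by push_cast; ring] at h
    · rw [Fintype.sum_prod_type, ← hab]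
      refine Finset.sum_congr rfl fun q _ => ?_
      have h : ∀ e, a q * edg K E e * (gst K E e * b q) =
          a q * (edg K E e * gst K E e) * b q := fun e => by simp only [mul_assoc]
      simp only [h]
      rw [← Finset.sum_mul, ← Finset.mul_sum, sum_edg_mul_gst E hE, mul_one]

namespace DualBasis

variable {P : GrProjModule (grading K E)} {k : ℤ}

lemma exists_dualBasis (P : GrProjModule (grading K E)) (hE : E.NoSinks) :
    ∃ (k : ℕ) (I : Type w) (_ : Fintype I) (f : I → V), Nonempty (DualBasis P k f) := by
  obtain ⟨m, d, x, c, hx, hc, hsum⟩ := P.exists_homogeneous_dualBasis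
  -- Any natural number bounding all degrees would do.
  let k : ℕ := ∑ i, (d i).toNat
  have hk : ∀ i, ∃ n : ℕ, (k : ℤ) = d i + n := fun i => by
    have : (d i).toNat ≤ k := Finset.single_le_sum (f := fun i => (d i).toNat)
      (fun _ _ => Nat.zero_le _) (Finset.mem_univ i)
    exact ⟨(k - d i).toNat, by omega⟩
  choose n hn using hk
  choose Q _ a b ha hb hab using fun i => exists_sum_mul_eq_one (K := K) hE (n i)
  let B : DualBasis P k (fun p : (Σ i, Q i) × V => p.2) :=
    { vec := fun p => op (vtx K E p.2) • op (a p.1.1 p.1.2) • x p.1.1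
      coord := fun p => (vtx K E p.2 * b p.1.1 p.1.2) • c p.1.1
      vec_mem := fun p => by
        have h := P.smul_mem (P.smul_mem (hx p.1.1) (ha p.1.1 p.1.2)) (vtx_mem E p.2)
        rwa [add_zero, ← hn] at h
      coord_mem := fun p l y hy => by
        have h := SetLike.mul_mem_graded (SetLike.mul_mem_graded (vtx_mem (K := K) E p.2)
          (hb p.1.1 p.1.2)) (hc p.1.1 l y hy)
        rw [show 0 + -(n p.1.1 : ℤ) + (l - d p.1.1) = l - k by rw [hn p.1.1]; ring] at h
        exact h
      vtx_smul_vec := fun p => by rw [← mul_smul, ← op_mul, vtx_mul_self]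
      vtx_mul_coord := fun p y => by
        rw [LinearMap.smul_apply, smul_eq_mul, ← mul_assoc, ← mul_assoc, vtx_mul_self]
      sum_smul := fun y => by
        rw [Fintype.sum_prod_type, Fintype.sum_sigma]
        conv_rhs => rw [← hsum y]
        refine Finset.sum_congr rfl fun i _ => ?_
        have h : ∀ q z, op (((vtx K E z * b i q) • c i) y) • op (vtx K E z) • op (a i q) • x i =
            op (a i q * vtx K E z * b i q * c i y) • x i := by
          intro q z
          rw [LinearMap.smul_apply, smul_eq_mul, ← mul_smul, ← mul_smul, ← op_mul, ← op_mul]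
          congr 2
          rw [← mul_assoc, ← mul_assoc, ← mul_assoc, mul_assoc (a i q), vtx_mul_self]
        simp only [h, ← Finset.sum_smul, ← Finset.op_sum, ← Finset.sum_mul, ← Finset.mul_sum,
          sum_vtx, mul_one, hab, one_mul] }
  -- The natural index type involves `V`, so it is replaced by a finite type in the universe of `W`.
  exact ⟨k, ULift (Fin (Fintype.card ((Σ i, Q i) × V))), inferInstance, _,
    ⟨B.reindex (Equiv.ulift.trans (Fintype.equivFin _).symm)⟩⟩

/-- Expanding `vec j` in the dual basis itself gives the relation ∑ (c_lj - δ_lj) `vec l` = 0. Where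
the matrix differs from the identity, the relation has an invertible coefficient and one member can
be dropped, so induction on the number of members applies. -/
lemma exists_isOrtho_of_scalar {I : Type w} [Fintype I] {f : I → V} (B : DualBasis P k f)
    (h : ∀ i j, B.coord i (B.vec j) ∈ bilevel K E 0 0) :
    ∃ (J : Type w) (_ : Fintype J) (g : J → V) (C : DualBasis P k g), C.IsOrtho := by
  classical
  induction hI : Fintype.card I generalizing I with
  | zero =>
    have := Fintype.card_eq_zero_iff.1 hI
    exact ⟨I, _, f, B, isEmptyElim, fun i => isEmptyElim i⟩
  | succ n ih =>
    obtain ⟨c, hc⟩ := exists_scalar B B h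
    by_cases hone : ∀ i j, c i j = if i = j then 1 else 0
    · refine ⟨I, _, f, B, fun i => ?_, fun i j hij => ?_⟩
      · rw [(hc i i).1, hone, if_pos rfl, one_smul]
      · rw [(hc i j).1, hone, if_neg hij, zero_smul]
    · push Not at hone
      obtain ⟨i, j, hij⟩ := hone
      let d : I → K := fun l => c l j - if l = j then 1 else 0
      have hdi : d i ≠ 0 := sub_ne_zero.2 hij
      have hd : ∀ l, f l ≠ f j → d l = 0 := fun l hl => by
        have : l ≠ j := fun h => hl (h ▸ rfl)
        simp [d, (hc l j).2 hl, this]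
      have hfij : f i = f j := by
        by_contra hne
        exact hdi (hd i hne)
      have hsum : ∑ l, op (d l • vtx K E (f i)) • B.vec l = 0 := by
        have h1 : ∀ l, op (d l • vtx K E (f i)) • B.vec l = op (B.coord l (B.vec j)) • B.vec l -
            if l = j then B.vec l else 0 := by
          intro l
          rw [(hc l j).1]
          by_cases hl : f l = f j
          · simp only [d]
            rw [hfij, ← hl, sub_smul, op_sub, sub_smul]
            congr 1
            split_ifs
            · rw [one_smul, B.vtx_smul_vec]
            · simp
          · have : l ≠ j := fun h => hl (h ▸ rfl)
            simp [hd l hl, (hc l j).2 hl, this]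
        simp only [h1, Finset.sum_sub_distrib, B.sum_smul]
        simp
      have hrest : ∑ l : {l // l ≠ i}, op (d l • vtx K E (f i)) • B.vec l =
          -(op (d i • vtx K E (f i)) • B.vec i) := by
        rw [eq_neg_iff_add_eq_zero, add_comm, ← hsum,
          ← Finset.add_sum_erase _ _ (Finset.mem_univ i)]
        congr 1
        symm
        apply Finset.sum_subtype
        simp
      -- The relation is solved for `vec i`.
      let t : {l // l ≠ i} → K := fun l => -(d i)⁻¹ * d l
      have ht : ∀ l : {l // l ≠ i}, f l ≠ f i → t l = 0 := fun l hl => by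
        simp [t, hd l (hfij ▸ hl)]
      have hti : ∑ l : {l // l ≠ i}, op (t l • vtx K E (f i)) • B.vec l = B.vec i := by
        have h1 : ∀ l : {l // l ≠ i}, op (t l • vtx K E (f i)) • B.vec l =
            op ((-(d i)⁻¹) • (1 : LeavittPathAlgebra K E)) •
              op (d l • vtx K E (f i)) • B.vec l := fun l => by
          rw [← mul_smul, ← op_mul, smul_mul_smul_comm, mul_one, mul_comm (d l)]
        simp only [h1, ← Finset.smul_sum, hrest]
        rw [smul_neg, ← mul_smul, ← op_mul, smul_mul_smul_comm, mul_one, mul_neg,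
          mul_inv_cancel₀ hdi, neg_smul, one_smul, op_neg, neg_smul, neg_neg, B.vtx_smul_vec]
      refine ih (B.remove i t ht hti) (fun l m => ?_) ?_
      · change B.coord l (B.vec m) + (t l • vtx K E (f i)) * B.coord i (B.vec m) ∈ _
        rw [smul_mul_assoc, B.vtx_mul_coord]
        exact add_mem (h _ _) (Submodule.smul_mem _ _ (h _ _))
      · rw [Fintype.card_subtype_compl, Fintype.card_subtype_eq, hI, Nat.add_sub_cancel]

lemma exists_isOrtho_of_mem_bilevel (hE : E.NoSinks) {n : ℕ} {I : Type w} [Fintype I] {f : I → V}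
    (B : DualBasis P k f) (h : ∀ i j, B.coord i (B.vec j) ∈ bilevel K E n n) :
    ∃ (J : Type w) (_ : Fintype J) (g : J → V) (C : DualBasis P (k + n) g), C.IsOrtho := by
  induction n generalizing k I with
  | zero =>
    rw [Nat.cast_zero, add_zero]
    exact B.exists_isOrtho_of_scalar h
  | succ n ih =>
    have key := ih (B.expand hE) fun p q => by
      rw [expand_coord_vec]
      exact mem_bilevel_succ_succ.1 (h p.1 q.1) p.2 q.2
    rwa [show k + 1 + (n : ℤ) = k + ((n + 1 : ℕ) : ℤ) by push_cast; ring] at key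

lemma exists_isOrtho (P : GrProjModule (grading K E)) (hE : E.NoSinks) :
    ∃ (k : ℕ) (I : Type w) (_ : Fintype I) (f : I → V) (B : DualBasis P k f), B.IsOrtho := by
  obtain ⟨k, I, _, f, ⟨B⟩⟩ := exists_dualBasis P hE
  obtain ⟨n, hn⟩ := (eventually_coord_mem_bilevel B B).exists
  obtain ⟨J, _, g, C, hC⟩ := B.exists_isOrtho_of_mem_bilevel hE hn
  have h : ∃ C' : DualBasis P ((k + n : ℕ) : ℤ) g, C'.IsOrtho := by
    rw [Nat.cast_add]
    exact ⟨C, hC⟩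
  exact ⟨k + n, J, _, g, h⟩

end DualBasis

end LeavittPathAlgebra

/-! ### Vertex modules and ranks. -/

/-- A graded retract of a group with an internal grading. -/
lemma DirectSum.IsInternal.of_retract {M N : Type*} [AddCommGroup M] [AddCommGroup N]
    {p : ℤ → AddSubgroup M} {q : ℤ → AddSubgroup N} (hp : DirectSum.IsInternal p)
    (i : N →+ M) (r : M →+ N) (hi : ∀ n x, x ∈ q n → i x ∈ p n) (hr : ∀ n x, x ∈ p n → r x ∈ q n)
    (h : ∀ x, r (i x) = x) : DirectSum.IsInternal q := by
  classical
  let i' : (⨁ n, q n) →+ ⨁ n, p n := DirectSum.map fun n =>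
    (i.comp (q n).subtype).codRestrict (p n) fun x => hi n x x.2
  let r' : (⨁ n, p n) →+ ⨁ n, q n := DirectSum.map fun n =>
    (r.comp (p n).subtype).codRestrict (q n) fun x => hr n x x.2
  have h1 : (DirectSum.coeAddMonoidHom p).comp i' = i.comp (DirectSum.coeAddMonoidHom q) := by
    apply DirectSum.addHom_ext
    intro n x
    simp only [i', AddMonoidHom.comp_apply, DirectSum.map_of, DirectSum.coeAddMonoidHom_of]
    rfl
  have h2 : (DirectSum.coeAddMonoidHom q).comp r' = r.comp (DirectSum.coeAddMonoidHom p) := by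
    apply DirectSum.addHom_ext
    intro n x
    simp only [r', AddMonoidHom.comp_apply, DirectSum.map_of, DirectSum.coeAddMonoidHom_of]
    rfl
  have h3 : r'.comp i' = AddMonoidHom.id _ := by
    apply DirectSum.addHom_ext
    intro n x
    simp only [r', i', AddMonoidHom.comp_apply, DirectSum.map_of, AddMonoidHom.id_apply]
    congr 1
    exact Subtype.ext (h x)
  constructor
  · intro x y hxy
    have h4 : i' x = i' y := hp.1 <| by
      rw [← AddMonoidHom.comp_apply, ← AddMonoidHom.comp_apply, h1, AddMonoidHom.comp_apply,
        AddMonoidHom.comp_apply, hxy]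
    rw [← AddMonoidHom.id_apply _ x, ← h3, AddMonoidHom.comp_apply, h4, ← AddMonoidHom.comp_apply,
      h3, AddMonoidHom.id_apply]
  · intro x
    obtain ⟨z, hz⟩ := hp.2 (i x)
    exact ⟨r' z, by rw [← AddMonoidHom.comp_apply, h2, AddMonoidHom.comp_apply, hz, h]⟩

namespace LeavittPathAlgebra

open LeavittGen DirectedGraph MulOpposite

variable {K : Type u} [Field K] {V : Type v} {W : Type w} [Fintype V] [Fintype W]
  {E : DirectedGraph V W}

variable (K E) in
/-- The right ideal generated by a vertex. -/
noncomputable def vertexIdeal (x : V) :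
    Submodule (LeavittPathAlgebra K E)ᵐᵒᵖ (LeavittPathAlgebra K E) where
  carrier := {a | vtx K E x * a = a}
  add_mem' {a b} ha hb := by
    change _ = _ at ha hb ⊢
    rw [mul_add, ha, hb]
  zero_mem' := mul_zero _
  smul_mem' a b hb := by
    change _ = _ at hb ⊢
    rw [MulOpposite.smul_eq_mul_unop, ← mul_assoc, hb]

lemma mem_vertexIdeal {x : V} {a : LeavittPathAlgebra K E} :
    a ∈ vertexIdeal K E x ↔ vtx K E x * a = a := Iff.rfl

variable (K E) in
/-- Left multiplication by a vertex. -/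
noncomputable def toVertexIdeal (x : V) : LeavittPathAlgebra K E →+ vertexIdeal K E x where
  toFun a := ⟨vtx K E x * a, by rw [mem_vertexIdeal, ← mul_assoc, vtx_mul_self]⟩
  map_zero' := Subtype.ext (mul_zero _)
  map_add' a b := Subtype.ext (mul_add _ _ _)

variable (K E) in
/-- Left multiplication by a vertex, as a linear map on the free module of rank one. -/
noncomputable def opToVertexIdeal (x : V) :
    (LeavittPathAlgebra K E)ᵐᵒᵖ →ₗ[(LeavittPathAlgebra K E)ᵐᵒᵖ] vertexIdeal K E x where
  toFun b := toVertexIdeal K E x (unop b)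
  map_add' _ _ := map_add _ _ _
  map_smul' _ _ := Subtype.ext (mul_assoc _ _ _).symm

lemma grading_isInternal :
    DirectSum.IsInternal fun n => (grading K E n).toAddSubgroup :=
  DirectSum.Decomposition.isInternal (grading K E)

variable (K E) in
/-- The graded projective module of a vertex. -/
noncomputable def vertexModule (x : V) : GrProjModule (grading K E) where
  carrier := vertexIdeal K E x
  deg n := (grading K E n).toAddSubgroup.comap (vertexIdeal K E x).subtype.toAddMonoidHom
  isInternal := grading_isInternal.of_retract (vertexIdeal K E x).subtype.toAddMonoidHom
    (toVertexIdeal K E x) (fun n a ha => ha)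
    (fun n a ha => by
      have h := SetLike.mul_mem_graded (vtx_mem (K := K) E x)
        (Submodule.mem_toAddSubgroup _ |>.1 ha)
      rw [zero_add] at h
      exact h)
    (fun a => Subtype.ext a.2)
  smul_mem i j m a hm ha := SetLike.mul_mem_graded (A := grading K E) hm ha
  finite := by
    exact Module.Finite.of_surjective (opToVertexIdeal K E x) fun a => ⟨op a, Subtype.ext a.2⟩
  projective := by
    refine Module.Projective.of_split (M := (LeavittPathAlgebra K E)ᵐᵒᵖ)
      { toFun := fun a => op (a : LeavittPathAlgebra K E)
        map_add' := fun a b => rfl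
        map_smul' := fun a b => rfl }
      (opToVertexIdeal K E x) ?_
    ext a
    exact a.2

/-- The graded module has a basis of degree `k` with `a x` members labelled by the vertex `x`. -/
def HasRank (P : GrProjModule (grading K E)) (k : ℤ) (a : V → ℤ) : Prop :=
  ∃ (I : Type w) (_ : Fintype I) (f : I → V) (B : DualBasis P k f), B.IsOrtho ∧
    a = fun x => (Nat.card {i // f i = x} : ℤ)

namespace HasRank

variable {P Q : GrProjModule (grading K E)} {k : ℤ} {a b : V → ℤ}

lemma nonneg (h : HasRank P k a) : 0 ≤ a := by
  obtain ⟨I, _, f, B, -, rfl⟩ := h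
  exact fun x => Int.natCast_nonneg _

lemma succ (h : HasRank P k a) (hE : E.NoSinks) :
    HasRank P (k + 1) (E.adjMatrix.transpose.mulVec a) := by
  obtain ⟨I, _, f, B, hB, rfl⟩ := h
  exact ⟨_, _, _, B.expand hE, hB.expand hE,
    funext fun x => (DualBasis.card_expandIndex E f x).symm⟩

lemma add_nat (h : HasRank P k a) (hE : E.NoSinks) (n : ℕ) :
    HasRank P (k + n) ((E.adjMatrix.transpose.mulVecLin ^ n) a) := by
  induction n with
  | zero => simpa using h
  | succ n ih =>
    rw [pow_succ', Module.End.mul_apply, Nat.cast_succ, ← add_assoc]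
    exact ih.succ hE

lemma exists_pow_eq (ha : HasRank P k a) (hb : HasRank P k b) (hE : E.NoSinks) :
    ∃ n : ℕ, (E.adjMatrix.transpose.mulVecLin ^ n) a = (E.adjMatrix.transpose.mulVecLin ^ n) b := by
  obtain ⟨I, _, f, B, hB, rfl⟩ := ha
  obtain ⟨J, _, g, C, hC, rfl⟩ := hb
  exact hB.exists_pow_mulVec_eq hC hE

lemma exists_nat (P : GrProjModule (grading K E)) (hE : E.NoSinks) :
    ∃ (k : ℕ) (a : V → ℤ), HasRank P k a := by
  obtain ⟨k, I, _, f, B, hB⟩ := DualBasis.exists_isOrtho P hE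
  exact ⟨k, _, I, _, f, B, hB, rfl⟩

lemma shift (h : HasRank P k a) (γ : ℤ) : HasRank (P.shift γ) (k - γ) a := by
  obtain ⟨I, _, f, B, hB, rfl⟩ := h
  let C : DualBasis (P.shift γ) (k - γ) f :=
    { vec := B.vec
      coord := B.coord
      vec_mem := fun i => by
        change B.vec i ∈ P.deg (γ + (k - γ))
        rw [add_sub_cancel]
        exact B.vec_mem i
      coord_mem := fun i n x hx => by
        have h := B.coord_mem i (γ + n) x hx
        rwa [show γ + n - k = n - (k - γ) by ring] at h
      vtx_smul_vec := B.vtx_smul_vec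
      vtx_mul_coord := B.vtx_mul_coord
      sum_smul := B.sum_smul }
  exact ⟨I, _, f, C, hB, rfl⟩

lemma directSum (ha : HasRank P k a) (hb : HasRank Q k b) :
    HasRank (P.directSum Q) k (a + b) := by
  obtain ⟨I, _, f, B, hB, rfl⟩ := ha
  obtain ⟨J, _, g, C, hC, rfl⟩ := hb
  let D : DualBasis (P.directSum Q) k (Sum.elim f g) :=
    { vec := Sum.elim (fun i => (B.vec i, (0 : Q.carrier))) (fun j => ((0 : P.carrier), C.vec j))
      coord := Sum.elim
        (fun i => (B.coord i).comp (LinearMap.fst (LeavittPathAlgebra K E)ᵐᵒᵖ P.carrier Q.carrier))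
        (fun j => (C.coord j).comp (LinearMap.snd (LeavittPathAlgebra K E)ᵐᵒᵖ P.carrier Q.carrier))
      vec_mem := by
        rintro (i | j)
        · exact ⟨B.vec_mem i, zero_mem _⟩
        · exact ⟨zero_mem _, C.vec_mem j⟩
      coord_mem := by
        rintro (i | j) n x hx
        · exact B.coord_mem i n _ hx.1
        · exact C.coord_mem j n _ hx.2
      vtx_smul_vec := by
        rintro (i | j)
        · exact Prod.ext (B.vtx_smul_vec i) (smul_zero _)
        · exact Prod.ext (smul_zero _) (C.vtx_smul_vec j)
      vtx_mul_coord := by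
        rintro (i | j) x
        · exact B.vtx_mul_coord i _
        · exact C.vtx_mul_coord j _
      sum_smul := by
        rintro ⟨x, y⟩
        rw [Fintype.sum_sum_type]
        have h1 : ∑ i, op (B.coord i x) • ((B.vec i, 0) : P.carrier × Q.carrier) = (x, 0) := by
          simp only [Prod.smul_mk, smul_zero]
          refine Prod.ext ?_ ?_
          · simpa [Prod.fst_sum] using B.sum_smul x
          · simp [Prod.snd_sum]
        have h2 : ∑ j, op (C.coord j y) • ((0, C.vec j) : P.carrier × Q.carrier) = (0, y) := by
          simp only [Prod.smul_mk, smul_zero]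
          refine Prod.ext ?_ ?_
          · simp [Prod.fst_sum]
          · simpa [Prod.snd_sum] using C.sum_smul y
        refine (congrArg₂ (· + ·) h1 h2).trans ?_
        exact Prod.ext (add_zero x) (zero_add y) }
  refine ⟨I ⊕ J, _, _, D, ⟨?_, ?_⟩, funext fun x => ?_⟩
  · rintro (i | j)
    · exact hB.1 i
    · exact hC.1 j
  · rintro (i | j) (i' | j') h
    · exact hB.2 i i' fun h' => h (h' ▸ rfl)
    · exact map_zero (B.coord i)
    · exact map_zero (C.coord j)
    · exact hC.2 j j' fun h' => h (h' ▸ rfl)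
  · rw [Nat.card_congr Equiv.subtypeSum, Nat.card_sum, Nat.cast_add]
    rfl

lemma trivial (k : ℤ) : HasRank (GrProjModule.trivial (grading K E)) k 0 := by
  let B : DualBasis (GrProjModule.trivial (grading K E)) k (PEmpty.elim : PEmpty.{w + 1} → V) :=
    { vec := PEmpty.elim
      coord := fun i => i.elim
      vec_mem := fun i => i.elim
      coord_mem := fun i => i.elim
      vtx_smul_vec := fun i => i.elim
      vtx_mul_coord := fun i => i.elim
      sum_smul := fun x => Subsingleton.elim (α := PUnit) _ _ }
  exact ⟨PEmpty, _, _, B, ⟨fun i => i.elim, fun i => i.elim⟩, funext fun x => by simp⟩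

lemma vertexModule [DecidableEq V] (x : V) : HasRank (vertexModule K E x) 0 (Pi.single x 1) := by
  let B : DualBasis (LeavittPathAlgebra.vertexModule K E x) 0 (fun _ : PUnit.{w + 1} => x) :=
    { vec := fun _ => (⟨vtx K E x, vtx_mul_self E x⟩ : vertexIdeal K E x)
      coord := fun _ => (vertexIdeal K E x).subtype
      vec_mem := fun _ => vtx_mem E x
      coord_mem := fun _ n y hy => by rw [sub_zero]; exact hy
      vtx_smul_vec := fun _ => Subtype.ext (vtx_mul_self E x)
      vtx_mul_coord := fun _ y => y.2
      sum_smul := fun y => by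
        rw [Fintype.sum_unique]
        exact Subtype.ext y.2 }
  refine ⟨PUnit, _, _, B, ⟨fun _ => rfl, fun i j h => (h rfl).elim⟩, funext fun y => ?_⟩
  rcases eq_or_ne x y with rfl | h
  · simp
  · simp [h, h.symm]

/-- The ranks realised in degree k form a submonoid, which contains the unit vectors because of the
shifted vertex modules. -/
lemma exists_of_nonneg (k : ℤ) {a : V → ℤ} (ha : 0 ≤ a) :
    ∃ P : GrProjModule (grading K E), HasRank P k a := by
  classical
  let S : AddSubmonoid (V → ℤ) :=
    { carrier := {a | ∃ P : GrProjModule (grading K E), HasRank P k a}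
      zero_mem' := ⟨_, trivial k⟩
      add_mem' := fun ⟨P, hP⟩ ⟨Q, hQ⟩ => ⟨_, hP.directSum hQ⟩ }
  have hS : ∀ x, Pi.single x 1 ∈ S := fun x =>
    ⟨_, by simpa using (vertexModule (K := K) (E := E) x).shift (-k)⟩
  have h : a = ∑ x, (a x).toNat • (Pi.single x 1 : V → ℤ) := by
    funext y
    simp [Finset.sum_apply, Pi.single_apply]
    exact ha y
  change a ∈ S
  rw [h]
  exact sum_mem fun x _ => nsmul_mem (hS x) _

/-- The coordinates of y are reused as coefficients on the other side. Orthogonality of C recovers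
them, since the common label fixes each coordinate. -/
lemma exists_linearMap {I : Type w} [Fintype I] {f : I → V} (B : DualBasis P k f)
    (C : DualBasis Q k f) (hC : C.IsOrtho) :
    ∃ T : P.carrier →ₗ[(LeavittPathAlgebra K E)ᵐᵒᵖ] Q.carrier,
      (∀ i y, C.coord i (T y) = B.coord i y) ∧ (∀ n y, y ∈ P.deg n → T y ∈ Q.deg n) := by
  classical
  let T : P.carrier →ₗ[(LeavittPathAlgebra K E)ᵐᵒᵖ] Q.carrier :=
    { toFun := fun y => ∑ i, op (B.coord i y) • C.vec i
      map_add' := fun y z => by simp [add_smul, Finset.sum_add_distrib]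
      map_smul' := fun c y => by
        induction c using MulOpposite.rec' with | _ c
        simp [mul_smul, Finset.smul_sum] }
  refine ⟨T, fun j y => ?_, fun n y hy => sum_mem fun i _ => ?_⟩
  · change C.coord j (∑ i, op (B.coord i y) • C.vec i) = _
    rw [map_sum, Finset.sum_eq_single j]
    · rw [C.coord_smul, hC.1, B.vtx_mul_coord]
    · intro i _ hij
      rw [C.coord_smul, hC.2 _ _ hij.symm, zero_mul]
    · exact fun h => (h (Finset.mem_univ j)).elim
  · have h := Q.smul_mem (C.vec_mem i) (B.coord_mem i n y hy)
    rwa [add_sub_cancel] at h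

lemma grIso (hP : HasRank P k a) (hQ : HasRank Q k a) : GrProjModule.GrIso P Q := by
  obtain ⟨I, _, f, B, hB, rfl⟩ := hP
  obtain ⟨J, _, g, C, hC, h⟩ := hQ
  have hfib : ∀ x, Nonempty ({i // f i = x} ≃ {j // g j = x}) := fun x =>
    (Finite.card_eq).1 (Nat.cast_injective (R := ℤ) (congrFun h x))
  let e : I ≃ J := Equiv.ofFiberEquiv fun x => (hfib x).some
  have he : g ∘ e = f := funext fun i => Equiv.ofFiberEquiv_map _ i
  -- `e` was built from the fibres of `f`, so its value is forgotten before `f` is replaced by `g ∘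
  -- e`.
  clear_value e
  subst he
  obtain ⟨T, hT, hTdeg⟩ := exists_linearMap B (C.reindex e) (hC.reindex e)
  obtain ⟨S, hS, hSdeg⟩ := exists_linearMap (C.reindex e) B hB
  have hST : ∀ y, S (T y) = y := fun y => by
    rw [← B.sum_smul (S (T y))]
    simp only [hS, hT, B.sum_smul]
  have hTS : ∀ y, T (S y) = y := fun y => by
    rw [← (C.reindex e).sum_smul (T (S y))]
    simp only [hS, hT, (C.reindex e).sum_smul]
  exact ⟨LinearEquiv.ofLinearMap T S (LinearMap.ext hTS) (LinearMap.ext hST),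
    fun n y => ⟨fun hy => hST y ▸ hSdeg n _ hy, fun hy => hTdeg n y hy⟩⟩

lemma of_grIso (hP : HasRank P k a) (h : GrProjModule.GrIso P Q) : HasRank Q k a := by
  obtain ⟨I, _, f, B, hB, rfl⟩ := hP
  obtain ⟨e, he⟩ := h
  let C : DualBasis Q k f :=
    { vec := fun i => e (B.vec i)
      coord := fun i => (B.coord i).comp e.symm.toLinearMap
      vec_mem := fun i => (he k _).2 (B.vec_mem i)
      coord_mem := fun i n y hy => B.coord_mem i n _
        ((he n _).1 ((e.apply_symm_apply y).symm ▸ hy))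
      vtx_smul_vec := fun i => by rw [← map_smul, B.vtx_smul_vec]
      vtx_mul_coord := fun i y => B.vtx_mul_coord i _
      sum_smul := fun y => by
        apply e.symm.injective
        simpa using B.sum_smul (e.symm y) }
  refine ⟨I, _, f, C, ⟨fun i => ?_, fun i j hij => ?_⟩, rfl⟩
  · simpa [C] using hB.1 i
  · simpa [C] using hB.2 i j hij

end HasRank

end LeavittPathAlgebra

/-! ### Elements of the dimension group and of the group completion. -/

namespace DimGroup

variable {V : Type v} [Fintype V] (M : Matrix V V ℤ)

lemma of_add_pow (k n : ℕ) (a : V → ℤ) : of M (k + n) ((M.mulVecLin ^ n) a) = of M k a := by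
  induction n with
  | zero => rfl
  | succ n ih =>
    rw [pow_succ', Module.End.mul_apply, ← ih]
    exact of_succ M (k + n) _

lemma exists_of (z : DimGroup M) : ∃ (k : ℕ) (a : V → ℤ), of M k a = z :=
  Module.DirectLimit.exists_of z

lemma exists_pow_eq_of_of_eq {k : ℕ} {a b : V → ℤ} (h : of M k a = of M k b) :
    ∃ n : ℕ, (M.mulVecLin ^ n) a = (M.mulVecLin ^ n) b := by
  obtain ⟨j, hj, h⟩ := Module.DirectLimit.exists_eq_of_of_eq h
  exact ⟨j - k, h⟩

end DimGroup

lemma Algebra.GrothendieckAddGroup.exists_of_sub_of {M : Type*} [AddCommMonoid M]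
    (z : Algebra.GrothendieckAddGroup M) : ∃ p q : M, z = of p - of q := by
  induction z using AddLocalization.ind with
  | H y =>
    refine ⟨y.1, y.2, eq_sub_of_add_eq ?_⟩
    change AddLocalization.mk y.1 y.2 + AddLocalization.mk _ 0 = AddLocalization.mk _ 0
    rw [AddLocalization.mk_add, AddLocalization.mk_eq_mk_iff, AddLocalization.r_iff_exists]
    exact ⟨0, by simp [add_comm]⟩

namespace GrK0

variable {K : Type v} {A : Type u} [CommRing K] [Ring A] [Algebra K A]
  (𝒜 : ℤ → Submodule K A) [GradedAlgebra 𝒜]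

lemma exists_of_sub_of (z : GrK0 𝒜) : ∃ p q, z = of 𝒜 p - of 𝒜 q :=
  Algebra.GrothendieckAddGroup.exists_of_sub_of z

/-- The extension of an additive map on `𝒱ᵍʳ` to `K₀ᵍʳ`. -/
noncomputable def lift {G : Type*} [AddCommGroup G] (f : GrV 𝒜 →+ G) : GrK0 𝒜 →+ G :=
  Algebra.GrothendieckAddGroup.lift f

lemma lift_of {G : Type*} [AddCommGroup G] (f : GrV 𝒜 →+ G) (p : GrV 𝒜) :
    lift 𝒜 f (of 𝒜 p) = f p :=
  DFunLike.congr_fun (Algebra.GrothendieckAddGroup.lift.symm_apply_apply f) p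

/-- An element of the completion is a difference of classes, and its vanishing under the lift
already makes the two classes equal in the monoid. -/
lemma lift_injective {G : Type*} [AddCommGroup G] {f : GrV 𝒜 →+ G}
    (hf : Function.Injective f) : Function.Injective (lift 𝒜 f) := by
  rw [injective_iff_map_eq_zero]
  intro z hz
  obtain ⟨p, q, rfl⟩ := exists_of_sub_of 𝒜 z
  rw [map_sub, lift_of, lift_of, sub_eq_zero] at hz
  rw [hf hz, sub_self]

end GrK0

/-! ### The isomorphism with the dimension group. -/

namespace LeavittPathAlgebra

variable {K : Type u} [Field K] {V : Type v} {W : Type w} [Fintype V] [Fintype W]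
  {E : DirectedGraph V W}

namespace HasRank

variable {P Q : GrProjModule (grading K E)} {k l : ℕ} {a b : V → ℤ}

/-- Both ranks are raised to the common degree k + l, where they agree up to a power of Aᵗ, which
the direct limit does not see. -/
lemma of_eq_of_grIso (ha : HasRank P k a) (hb : HasRank Q l b) (hE : E.NoSinks)
    (h : GrProjModule.GrIso P Q) :
    DimGroup.of E.adjMatrix.transpose k a = DimGroup.of E.adjMatrix.transpose l b := by
  have ha' := ((ha.of_grIso h).add_nat hE l)
  have hb' := hb.add_nat hE k
  rw [add_comm] at hb'
  obtain ⟨n, hn⟩ := ha'.exists_pow_eq hb' hE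
  rw [← DimGroup.of_add_pow _ k l, ← DimGroup.of_add_pow _ l k, add_comm l k,
    ← DimGroup.of_add_pow _ (k + l) n, hn, DimGroup.of_add_pow]

/-- Equality in the limit is equality at some finite stage; after expanding both modules to that
degree their ranks coincide. -/
lemma grIso_of_of_eq (ha : HasRank P k a) (hb : HasRank Q l b) (hE : E.NoSinks)
    (h : DimGroup.of E.adjMatrix.transpose k a = DimGroup.of E.adjMatrix.transpose l b) :
    GrProjModule.GrIso P Q := by
  have ha' := ha.add_nat hE l
  have hb' := hb.add_nat hE k
  rw [add_comm] at hb'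
  rw [← DimGroup.of_add_pow _ k l, ← DimGroup.of_add_pow _ l k, add_comm l k] at h
  obtain ⟨n, hn⟩ := DimGroup.exists_pow_eq_of_of_eq _ h
  exact (ha'.add_nat hE n).grIso (hn ▸ hb'.add_nat hE n)

end HasRank

/-- The class in the dimension group of a graded projective module. -/
noncomputable def dimClass (hE : E.NoSinks) (P : GrProjModule (grading K E)) :
    DimGroup E.adjMatrix.transpose :=
  DimGroup.of _ (HasRank.exists_nat P hE).choose (HasRank.exists_nat P hE).choose_spec.choose

lemma HasRank.dimClass_eq {P : GrProjModule (grading K E)} {k : ℕ} {a : V → ℤ}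
    (h : HasRank P k a) (hE : E.NoSinks) : dimClass hE P = DimGroup.of _ k a :=
  (HasRank.exists_nat P hE).choose_spec.choose_spec.of_eq_of_grIso h hE (.refl P)

variable (K) in
/-- The map from `𝒱ᵍʳ` to the dimension group. -/
noncomputable def dimHom (hE : E.NoSinks) :
    GrV (grading K E) →+ DimGroup E.adjMatrix.transpose where
  toFun := Quotient.lift (dimClass hE) fun P Q h => by
    obtain ⟨k, a, hP⟩ := HasRank.exists_nat P hE
    rw [hP.dimClass_eq hE, (hP.of_grIso h).dimClass_eq hE]
  map_zero' := by
    change dimClass hE (GrProjModule.trivial _) = 0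
    rw [(HasRank.trivial ((0 : ℕ) : ℤ)).dimClass_eq hE, map_zero]
  map_add' := by
    rintro ⟨P⟩ ⟨Q⟩
    change dimClass hE (P.directSum Q) = dimClass hE P + dimClass hE Q
    obtain ⟨k, a, hP⟩ := HasRank.exists_nat P hE
    obtain ⟨l, b, hQ⟩ := HasRank.exists_nat Q hE
    -- Ranks add only in a common degree, here k + l.
    have hP' := hP.add_nat hE l
    have hQ' := hQ.add_nat hE k
    rw [add_comm] at hQ'
    rw [← Nat.cast_add] at hP' hQ'
    rw [hP'.dimClass_eq hE, hQ'.dimClass_eq hE, (hP'.directSum hQ').dimClass_eq hE, map_add]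

lemma dimHom_injective (hE : E.NoSinks) : Function.Injective (dimHom K hE) := by
  rintro ⟨P⟩ ⟨Q⟩ h
  change dimClass hE P = dimClass hE Q at h
  obtain ⟨k, a, hP⟩ := HasRank.exists_nat P hE
  obtain ⟨l, b, hQ⟩ := HasRank.exists_nat Q hE
  rw [hP.dimClass_eq hE, hQ.dimClass_eq hE] at h
  exact Quotient.sound (hP.grIso_of_of_eq hQ hE h)

lemma range_dimHom (hE : E.NoSinks) :
    Set.range (dimHom K hE) = DimGroup.cone E.adjMatrix.transpose := by
  ext z
  constructor
  · rintro ⟨⟨P⟩, rfl⟩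
    obtain ⟨k, a, hP⟩ := HasRank.exists_nat P hE
    exact ⟨k, a, hP.nonneg, (hP.dimClass_eq hE).symm⟩
  · rintro ⟨k, a, ha, rfl⟩
    obtain ⟨P, hP⟩ := HasRank.exists_of_nonneg (K := K) (E := E) k ha
    exact ⟨Quotient.mk _ P, hP.dimClass_eq hE⟩

lemma dimHom_shift (hE : E.NoSinks) (p : GrV (grading K E)) :
    dimHom K hE (GrV.shift _ 1 p) = DimGroup.delta _ (dimHom K hE p) := by
  induction p using Quotient.inductionOn with | _ P
  change dimClass hE (P.shift 1) = DimGroup.mulHom _ (dimClass hE P)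
  obtain ⟨k, a, hP⟩ := HasRank.exists_nat P hE
  -- Expansion moves the generators to degree k + 1 and the shift brings them back to k, so only the
  -- factor Aᵗ remains.
  have h := (hP.succ hE).shift 1
  rw [add_sub_cancel_right] at h
  rw [hP.dimClass_eq hE, h.dimClass_eq hE, DimGroup.mulHom_of]

lemma lift_dimHom_surjective (hE : E.NoSinks) :
    Function.Surjective (GrK0.lift (grading K E) (dimHom K hE)) := by
  intro z
  obtain ⟨k, a, rfl⟩ := DimGroup.exists_of _ z
  have h : ∀ b : V → ℤ, 0 ≤ b → ∃ p, dimHom K hE p = DimGroup.of _ k b := fun b hb =>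
    (range_dimHom (K := K) hE).symm.subset ⟨k, b, hb, rfl⟩
  obtain ⟨p, hp⟩ := h a⁺ (posPart_nonneg a)
  obtain ⟨q, hq⟩ := h a⁻ (negPart_nonneg a)
  refine ⟨GrK0.of _ p - GrK0.of _ q, ?_⟩
  rw [map_sub, GrK0.lift_of, GrK0.lift_of, hp, hq, ← map_sub, posPart_sub_negPart]

end LeavittPathAlgebra

open LeavittPathAlgebra in
theorem lemma5p1 {K : Type u} [Field K] {V : Type v} {W : Type w} [Fintype V] [Fintype W]
    (E : DirectedGraph V W) (hE : E.NoSinks) :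
    ∃ φ : GrK0 (LeavittPathAlgebra.grading K E) ≃+ DimGroup E.adjMatrix.transpose,
      (∀ α : GrK0 (LeavittPathAlgebra.grading K E),
        φ ((LaurentPolynomial.T 1 : LaurentPolynomial ℤ) • α) =
          DimGroup.delta E.adjMatrix.transpose (φ α)) ∧
      φ '' GrK0.cone (LeavittPathAlgebra.grading K E) = DimGroup.cone E.adjMatrix.transpose := by
  refine ⟨AddEquiv.ofBijective (GrK0.lift _ (dimHom K hE))
    ⟨GrK0.lift_injective _ (dimHom_injective hE), lift_dimHom_surjective hE⟩, fun α => ?_, ?_⟩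
  · rw [GrK0.T_smul]
    obtain ⟨p, q, rfl⟩ := GrK0.exists_of_sub_of _ α
    change GrK0.lift _ (dimHom K hE) _ = DimGroup.delta _ (GrK0.lift _ (dimHom K hE) _)
    simp only [map_sub, GrK0.shift_of, GrK0.lift_of, dimHom_shift]
  · rw [GrK0.cone, ← Set.range_comp, ← range_dimHom (K := K) hE]
    exact congrArg Set.range (funext fun p => GrK0.lift_of _ _ p)
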